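/- Let $d\ge 0$, $n_i\ge 0$, $k_i\ge 1$ ($1\le i\le d$) be integers and $\alpha>0$. The *pre-Segre–Veronese manifold* $\mathcal P$ is $\mathbb R_{>0}\times\mathbb S^{n_1-1}\times\cdots\times\mathbb S^{n_d-1}$ with the Riemannian metric $$g_{(\lambda,\mathbf u_1,\dots,\mathbf u_d)}\bigl((\dot x,\dot{\mathbf u}_1,\dots,\dot{\mathbf u}_d),(\dot y,\dot{\mathbf v}_1,\dots,\dot{\mathbf v}_d)\bigr)=\dot x\dot y+(\alpha\lambda)^2\sum_{i=1}^d k_i\langle\dot{\mathbf u}_i,\dot{\mathbf v}_i\rangle .$$ Let $\otimes(\lambda,\mathbf u_1,\dots,\mathbf u_d)=\lambda\,\mathbf u_1^{\otimes k_1}\otimes\cdots\otimes\mathbf u_d^{\otimes k_d}\in\mathbb R^{n_1^{k_1}\times\cdots\times n_d^{k_d}}$. The *$\alpha$-warped Segre–Veronese manifold* $\mathcal S=\otimes(\mathcal P)$ carries the restriction of the $\alpha$-warped metric of the punctured Euclidean space of arrays, which at $\lambda\,\mathcal U$ with $\lambda>0$, $\|\mathcal U\|=1$ is $$\varsigma^\alpha_{\lambda\,\mathcal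 U}(\dot x\,\mathcal U+\lambda\dot{\mathcal V},\ \dot y\,\mathcal U+\lambda\dot{\mathcal W})=\dot x\dot y+(\alpha\lambda)^2\langle\dot{\mathcal V},\dot{\mathcal W}\rangle,\qquad \dot{\mathcal V},\dot{\mathcal W}\perp\mathcal U .$$ On a Riemannian manifold $\mathcal M$, the distance is the infimum of the lengths of piecewise smooth connecting curves ($\infty$ if there are none), and a geodesic is a piecewise smooth curve of constant speed that is a critical point of the length under variations with fixed end points. Let $\exp_x(v)=\gamma(1)$ for the geodesic $\gamma\colon[0,1]\to\mathcal M$ with $\gamma(0)=x$, $\gamma'(0)=v$, if it exists. Let $\operatorname{Log}_x(y)$ be the set of the $v\in \mathrm T_x\mathcal M$ with $\exp_x(v)=y$ and $\|v\|_x=\operatorname{dist}(x,y)$, i.e. of the initial velocities of the constant-speed minimizing geodesics on $[0,1]$ from $x$ to $y$; when it has exactly one element, this element is $\log_x y$. For $p=(\lambda,\mathbf u_1,\dots,\mathbf u_d)$ and $q=(\mu,\mathbf v_1,\dots,\mathbf v_d)$ in $\mathcal P$ let $\theta_i=\arccos\langle\mathbf u_i,\mathbf v_i\rangle\in[0,\pi]$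 and $M(p,q)=\sqrt{\sum_i k_i\theta_i^2}$. The points $p,q$ are *$\alpha$-compatible* if $M(p,q)<\pi/\alpha$. For $P,Q\in\mathcal S$, the pair $(p,q)$ is a pair of *matched representatives* of $(P,Q)$ if it minimizes $M$ over $\otimes^{-1}(P)\times\otimes^{-1}(Q)$. **Theorem.** Let $P,Q\in\mathcal S$ and let $p=(\lambda,\mathbf u_1,\dots,\mathbf u_d)\in\otimes^{-1}(P)$, $q=(\mu,\mathbf v_1,\dots,\mathbf v_d)\in\otimes^{-1}(Q)$ be matched, $\alpha$-compatible representatives. Then $(\mathrm d_p\otimes)(w)\in\operatorname{Log}_P(Q)$ for every $w\in\operatorname{Log}_p(q)$. Suppose moreover that $\mathbf u_i\ne-\mathbf v_i$ for all $i$, and put $M=M(p,q)$. Then: 1. $\log_p q$ is well defined (that is, $\operatorname{Log}_p(q)$ has exactly one element), and $$\log_p q=\bigl(\mu\cos(\alpha M)-\lambda,\ \dot{\mathbf u}_1,\dots,\dot{\mathbf u}_d\bigr),\qquad \dot{\mathbf u}_i=\frac{\mu\,\sin(\alpha M)\,\theta_i}{\lambda\,\alpha M\,\sin\theta_i}\bigl(\mathbf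 v_i-\langle\mathbf u_i,\mathbf v_i\rangle\mathbf u_i\bigr),$$ where $\sin(x)/x$ and $x/\sin(x)$ are read as $1$ at $x=0$. 2. $(\mathrm d_p\otimes)(\log_p q)\in\operatorname{Log}_P(Q)$, i.e. it is the initial velocity of a constant-speed minimizing geodesic on $[0,1]$ from $P$ to $Q$. 3. If $q$ is the only point of $\mathcal P$ such that $(p,q)$ is a pair of matched representatives of $(P,Q)$, then $\log_P Q$ is well defined and $$\log_P Q=(\mathrm d_p\otimes)(\log_p q).$$ -/

import Mathlib

open scoped ContDiff

noncomputable section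

namespace SegreVeronese

section Riemannian

/-! Riemannian geometry of a subset `M` of a normed space `E` (in the applications an embedded
submanifold), with a Riemannian metric `g`: `g x v w` is the inner product at `x ∈ M` of the tangent
vectors `v` and `w`, which are regarded as elements of `E`.  All curves are considered on the
parameter interval `[0, 1]`. -/

variable {E : Type*} [NormedAddCommGroup E] [NormedSpace ℝ E]

/-- `γ` is a piecewise smooth curve in `M`: away from finitely many break points it is smooth, up to
and including the end points of every closed interval that has no break point in its interior. -/
def IsPiecewiseSmoothCurve (M : Set E) (γ : ℝ → E) : Prop :=
  ContinuousOn γ (Set.Icc 0 1) ∧ (∀ t ∈ Set.Icc (0 : ℝ) 1, γ t ∈ M) ∧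
    ∃ S : Finset ℝ, ∀ a b : ℝ, 0 ≤ a → a < b → b ≤ 1 → (∀ t ∈ Set.Ioo a b, t ∉ S) →
      ContDiffOn ℝ ∞ γ (Set.Icc a b)

/-- The norm of the velocity of `γ` at time `t`. -/
def speed (g : E → E → E → ℝ) (γ : ℝ → E) (t : ℝ) : ℝ :=
  √(g (γ t) (deriv γ t) (deriv γ t))

/-- The length of `γ`. -/
def curveLength (g : E → E → E → ℝ) (γ : ℝ → E) : ENNReal :=
  ∫⁻ t in Set.Icc (0 : ℝ) 1, ENNReal.ofReal (speed g γ t)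

/-- The intrinsic distance: the infimum of the lengths of the piecewise smooth curves in `M` from `x`
to `y` (and `⊤` if there is no such curve). -/
def intrinsicDist (M : Set E) (g : E → E → E → ℝ) (x y : E) : ENNReal :=
  ⨅ (γ : ℝ → E) (_ : IsPiecewiseSmoothCurve M γ ∧ γ 0 = x ∧ γ 1 = y), curveLength g γ

/-- `Γ s t` (for `s` near `0` and `t ∈ [0, 1]`) is a piecewise smooth variation with fixed end points
in `M` of the curve `γ`. -/
def IsVariation (M : Set E) (γ : ℝ → E) (Γ : ℝ → ℝ → E) : Prop :=
  (∀ t ∈ Set.Icc (0 : ℝ) 1, Γ 0 t = γ t) ∧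
  ∃ ε > 0,
    (∀ s ∈ Set.Ioo (-ε) ε, Γ s 0 = γ 0 ∧ Γ s 1 = γ 1) ∧
    (∀ s ∈ Set.Ioo (-ε) ε, ∀ t ∈ Set.Icc (0 : ℝ) 1, Γ s t ∈ M) ∧
    ContinuousOn (fun z : ℝ × ℝ => Γ z.1 z.2) (Set.Ioo (-ε) ε ×ˢ Set.Icc 0 1) ∧
    ∃ S : Finset ℝ, ∀ a b : ℝ, 0 ≤ a → a < b → b ≤ 1 → (∀ t ∈ Set.Ioo a b, t ∉ S) →
      ContDiffOn ℝ ∞ (fun z : ℝ × ℝ => Γ z.1 z.2) (Set.Ioo (-ε) ε ×ˢ Set.Icc a b)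

/-- `γ` is a constant-speed geodesic of `(M, g)`: a piecewise smooth curve of constant speed that is a
critical point of the length functional under variations with fixed end points.  (Along a variation
of a curve of positive constant speed the length is differentiable at `0`; a curve of speed zero is
constant and minimizes the length, and then the derivative vanishes whenever it exists.) -/
def IsGeodesic (M : Set E) (g : E → E → E → ℝ) (γ : ℝ → E) : Prop :=
  IsPiecewiseSmoothCurve M γ ∧
  (∃ c : ℝ, ∀ t ∈ Set.Ioo (0 : ℝ) 1, DifferentiableAt ℝ γ t → speed g γ t = c) ∧
  ∀ Γ : ℝ → ℝ → E, IsVariation M γ Γ →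
    ∀ δ : ℝ, HasDerivAt (fun s => (curveLength g (Γ s)).toReal) δ 0 → δ = 0

/-- The graph of the exponential map: `exp_x v = y` means that a constant-speed geodesic on `[0, 1]`
with initial point `x` and initial velocity `v` ends in `y`. -/
def IsExp (M : Set E) (g : E → E → E → ℝ) (x v y : E) : Prop :=
  ∃ γ : ℝ → E, IsGeodesic M g γ ∧ γ 0 = x ∧ HasDerivWithinAt γ v (Set.Icc 0 1) 0 ∧ γ 1 = y

/-- The (a priori set-valued) logarithmic map: the tangent vectors `v` at `x` with `exp_x v = y` whose
norm is the distance from `x` to `y`, that is, the initial velocities of the constant-speed minimizing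
geodesics from `x` to `y`.  The logarithm is well defined when this set is a singleton. -/
def logSet (M : Set E) (g : E → E → E → ℝ) (x y : E) : Set E :=
  {v | IsExp M g x v y ∧ ENNReal.ofReal (√(g x v v)) = intrinsicDist M g x y}

end Riemannian

section Manifolds

variable {d : ℕ}

/-- The space of `n₁^{k₁} × ⋯ × n_d^{k_d}` real arrays, with the Euclidean inner product. -/
abbrev TensorSpace (n k : Fin d → ℕ) : Type :=
  EuclideanSpace ℝ ((i : Fin d) → Fin (k i) → Fin (n i))

/-- The vector space `ℝ × ℝ^{n₁} × ⋯ × ℝ^{n_d}`. -/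
abbrev PreSpace (n : Fin d → ℕ) : Type :=
  ℝ × ((i : Fin d) → EuclideanSpace ℝ (Fin (n i)))

/-- The map `⊗ : (l, u₁, …, u_d) ↦ l u₁^{⊗ k₁} ⊗ ⋯ ⊗ u_d^{⊗ k_d}`. -/
def tensorMap (n k : Fin d → ℕ) (p : PreSpace n) : TensorSpace n k :=
  WithLp.toLp 2 fun J => p.1 * ∏ i, ∏ j, p.2 i (J i j)

/-- The underlying set `ℝ_{>0} × 𝕊^{n₁-1} × ⋯ × 𝕊^{n_d-1}` of the pre-Segre–Veronese manifold. -/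
def preSegreVeronese (n : Fin d → ℕ) : Set (PreSpace n) :=
  {p | 0 < p.1 ∧ ∀ i, ‖p.2 i‖ = 1}

/-- The Riemannian metric of the `α`-warped pre-Segre–Veronese manifold. -/
def preMetric (n k : Fin d → ℕ) (α : ℝ) (p v w : PreSpace n) : ℝ :=
  v.1 * w.1 + (α * p.1) ^ 2 * ∑ i, (k i : ℝ) * inner ℝ (v.2 i) (w.2 i)

/-- The underlying set of the (positive) Segre–Veronese manifold. -/
def segreVeronese (n k : Fin d → ℕ) : Set (TensorSpace n k) :=
  tensorMap n k '' preSegreVeronese n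

/-- The `α`-warped metric on a punctured inner product space.  Let `x = l u` with `l > 0` and
`‖u‖ = 1`, and write a tangent vector as `v = r u + l v'` with `r ∈ ℝ` and `v' ⊥ u`, similarly
`w = s u + l w'`.  The value is `r s + (α l)² ⟨v', w'⟩ = r s + α² ⟨v - r u, w - s u⟩`, where
`r = ⟨u, v⟩` and `s = ⟨u, w⟩`. -/
def warpedMetric {V : Type*} [NormedAddCommGroup V] [InnerProductSpace ℝ V]
    (α : ℝ) (x v w : V) : ℝ :=
  let u : V := ‖x‖⁻¹ • x
  inner ℝ u v * inner ℝ u w + α ^ 2 * inner ℝ (v - inner ℝ u v • u) (w - inner ℝ u w • u)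

/-- The weighted spherical distance `M(p, q)`. -/
def sphericalDist {n : Fin d → ℕ} (k : Fin d → ℕ) (p q : PreSpace n) : ℝ :=
  √(∑ i, (k i : ℝ) * InnerProductGeometry.angle (p.2 i) (q.2 i) ^ 2)

/-- `p` and `q` are `α`-compatible. -/
def IsCompatible {n : Fin d → ℕ} (k : Fin d → ℕ) (α : ℝ) (p q : PreSpace n) : Prop :=
  sphericalDist k p q < α⁻¹ * Real.pi

/-- `p` is a representative of the tensor `P`. -/
def IsRepresentative {n k : Fin d → ℕ} (p : PreSpace n) (P : TensorSpace n k) : Prop :=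
  p ∈ preSegreVeronese n ∧ tensorMap n k p = P

/-- `p` and `q` are matched representatives of `P` and `Q`. -/
def IsMatched {n k : Fin d → ℕ} (P Q : TensorSpace n k) (p q : PreSpace n) : Prop :=
  IsRepresentative p P ∧ IsRepresentative q Q ∧
    ∀ p' q' : PreSpace n, IsRepresentative p' P → IsRepresentative q' Q →
      sphericalDist k p q ≤ sphericalDist k p' q'

/-- The closed form of the logarithm of `q = (μ, v₁, …, v_d)` at `p = (l, u₁, …, u_d)` on the
`α`-warped pre-Segre–Veronese manifold: with `M = M(p, q)` and `θᵢ` the angle between `uᵢ` and `vᵢ`,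
`(μ cos (α M) - l, …, (μ sin (α M) θᵢ / (l α M sin θᵢ)) (vᵢ - ⟨uᵢ, vᵢ⟩ uᵢ), …)`,
where `Real.sinc x` is `sin x / x`, and `1` at `x = 0`. -/
def preLog {n : Fin d → ℕ} (k : Fin d → ℕ) (α : ℝ) (p q : PreSpace n) : PreSpace n :=
  (q.1 * Real.cos (α * sphericalDist k p q) - p.1,
    fun i => (q.1 * Real.sinc (α * sphericalDist k p q) /
        (p.1 * Real.sinc (InnerProductGeometry.angle (p.2 i) (q.2 i)))) •
      (q.2 i - (inner ℝ (p.2 i) (q.2 i) : ℝ) • p.2 i))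

end Manifolds

end SegreVeronese

end

/-! The manifold `preSegreVeronese n` is a cone over a product of spheres: its metric is `dr² + (α
r)² ∑ kᵢ |duᵢ|²`. Such a cone is compared with the Euclidean plane in polar coordinates, whose
metric is `dr² + r² dφ²`, by sending the weighted spherical distance `M` to the angle `φ = α M`.

Lower bound: keep the radius of a curve and replace its spherical part by `α` times a weighted sum
of the angles to the starting point. By Cauchy–Schwarz this map into the plane does not increase
speed, and suitable weights realise every final angle up to `α M`. So a curve is at least as long as
the chord between the polar points `(r, 0)` and `(r', α m)`, for every `0 ≤ m ≤ M`
(`ofReal_norm_sub_le_lintegral_speed`).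

Upper bound and uniqueness: if `α M < π`, the planar chord avoids the origin and lifts to a curve of
the same constant speed (`speed_coneGeodesic`), so the distance is the chord length
(`intrinsicDist_eq_coneDist`). A constant-speed minimizer gives equality in the planar triangle
inequality, which fixes radius and angle at each time. Equality in the triangle inequality for `M`
then puts each component on its great circle (`eqOn_coneGeodesic`). The initial velocity of the
lifted chord is `preLog`.

Passage to tensors: `⊗` is a local isometry (`warpedMetric_fderiv_tensorMap`) and curves lift
through it (`exists_lift`). A curve from `P` to `Q` lifts to one from `p` to some representative of
`Q`. All of these have the same radius, and planar distance increases with the angle on `[0, π]`, so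
matched representatives give the shortest lifts. If `q` is the only partner of `p`, every minimizer
lifts to a curve ending in `q`, and uniqueness descends.

Finally, a length-minimizing curve of constant speed is automatically a critical point of the length
(`mem_logSet_iff`), so no geodesic equation is needed. -/

noncomputable section

namespace SegreVeronese

open MeasureTheory Set Filter Topology

/-! ### Piecewise smooth curves, their lengths, and minimizers as geodesics. -/

section Curves

/-- A relation between the end points of intervals that can be concatenated, and that holds for the
intervals without a point of a finite set in their interior, holds for all intervals. -/
theorem rel_of_forall_free {R : ℝ → ℝ → Prop}
    (htrans : ∀ a c b, a < c → c < b → R a c → R c b → R a b) (S : Finset ℝ)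
    (hfree : ∀ a b, a < b → (∀ t ∈ Ioo a b, t ∉ S) → R a b) : ∀ a b, a < b → R a b := by
  classical
  induction S using Finset.induction_on with
  | empty => exact fun a b hab => hfree a b hab (by simp)
  | insert s S _ ih =>
    refine ih fun a b hab hS => ?_
    by_cases hs : s ∈ Ioo a b
    · refine htrans a s b hs.1 hs.2 (hfree a s hs.1 fun t ht => ?_) (hfree s b hs.2 fun t ht => ?_)
      · simp only [Finset.mem_insert, not_or]
        exact ⟨ht.2.ne, hS t ⟨ht.1, ht.2.trans hs.2⟩⟩
      · simp only [Finset.mem_insert, not_or]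
        exact ⟨ht.1.ne', hS t ⟨hs.1.trans ht.1, ht.2⟩⟩
    · refine hfree a b hab fun t ht => ?_
      simp only [Finset.mem_insert, not_or]
      exact ⟨fun h => hs (h ▸ ht), hS t ht⟩

theorem setLIntegral_Icc_add {f : ℝ → ENNReal} {a c b : ℝ} (hac : a ≤ c) (hcb : c ≤ b) :
    (∫⁻ t in Icc a c, f t) + ∫⁻ t in Icc c b, f t = ∫⁻ t in Icc a b, f t := by
  rw [← restrict_Ioc_eq_restrict_Icc, ← restrict_Ioc_eq_restrict_Icc, ← restrict_Ioc_eq_restrict_Icc,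
    ← Ioc_union_Ioc_eq_Ioc hac hcb, lintegral_union measurableSet_Ioc]
  exact Set.disjoint_left.2 fun x hx hx' => absurd hx.2 (not_le.2 hx'.1)

/-- Two functions that agree in the interior of an interval, off a finite set, have the same integral
over the interval. -/
theorem setLIntegral_Icc_congr {f h : ℝ → ENNReal} {a b : ℝ} (S : Finset ℝ)
    (hfh : ∀ t ∈ Ioo a b, t ∉ S → f t = h t) :
    ∫⁻ t in Icc a b, f t = ∫⁻ t in Icc a b, h t := by
  apply lintegral_congr_ae
  rw [← restrict_Ioo_eq_restrict_Icc]
  have hS : ∀ᵐ t ∂(volume.restrict (Ioo a b)), t ∉ (S : Set ℝ) :=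
    ae_restrict_of_ae (S.finite_toSet.countable.ae_notMem volume)
  filter_upwards [self_mem_ae_restrict measurableSet_Ioo, hS] with t ht htS
  exact hfh t ht (by simpa using htS)

theorem eventuallyEq_of_eqOn_Icc {X : Type*} {γ β : ℝ → X} {a b t : ℝ} (h : EqOn γ β (Icc a b))
    (ht : t ∈ Ioo a b) : γ =ᶠ[𝓝 t] β := by
  filter_upwards [Icc_mem_nhds ht.1 ht.2] with s hs using h hs

variable {E : Type*} [NormedAddCommGroup E] [NormedSpace ℝ E]

theorem speed_congr {g : E → E → E → ℝ} {γ β : ℝ → E} {t : ℝ} (h : γ =ᶠ[𝓝 t] β) :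
    speed g γ t = speed g β t := by
  rw [speed, speed, h.eq_of_nhds, h.deriv_eq]

theorem setLIntegral_speed_congr {g : E → E → E → ℝ} {γ β : ℝ → E} {a b : ℝ}
    (h : EqOn γ β (Icc a b)) :
    ∫⁻ t in Icc a b, ENNReal.ofReal (speed g γ t) =
      ∫⁻ t in Icc a b, ENNReal.ofReal (speed g β t) :=
  setLIntegral_Icc_congr ∅ fun _ ht _ => by
    rw [speed_congr (eventuallyEq_of_eqOn_Icc h ht)]

theorem IsPiecewiseSmoothCurve.congr {M : Set E} {γ β : ℝ → E} (h : IsPiecewiseSmoothCurve M γ)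
    (hβ : EqOn β γ (Icc 0 1)) : IsPiecewiseSmoothCurve M β := by
  obtain ⟨h1, h2, S, hS⟩ := h
  refine ⟨h1.congr hβ, fun t ht => by rw [hβ ht]; exact h2 t ht, S, fun a b ha hab hb hf => ?_⟩
  exact (hS a b ha hab hb hf).congr fun t ht => hβ ⟨ha.trans ht.1, ht.2.trans hb⟩

/-- A finite set splits any bounded interval: to the right of a point there is a free interval. -/
theorem exists_free_right (S : Finset ℝ) (a b : ℝ) (hab : a < b) :
    ∃ c, a < c ∧ c ≤ b ∧ ∀ t ∈ Ioo a c, t ∉ S := by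
  have h : ∀ᶠ t in 𝓝[>] a, t ∉ S := by
    have : ∀ᶠ t in 𝓝[≠] a, t ∉ (S : Set ℝ) := by
      have := (S.finite_toSet.subset (Set.sdiff_subset : (S : Set ℝ) \ {a} ⊆ S)).isClosed.isOpen_compl.mem_nhds
        (x := a) (by simp)
      filter_upwards [mem_nhdsWithin_of_mem_nhds this, self_mem_nhdsWithin] with t ht hta h
      exact ht ⟨h, hta⟩
    exact this.filter_mono (nhdsWithin_mono _ fun x hx => ne_of_gt hx)
  obtain ⟨c, hc, hcS⟩ := (mem_nhdsGT_iff_exists_Ioo_subset' hab).1 h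
  exact ⟨min c b, lt_min hc hab, min_le_right _ _,
    fun t ht => hcS ⟨ht.1, ht.2.trans_le (min_le_left _ _)⟩⟩

theorem exists_free_left (S : Finset ℝ) (a b : ℝ) (hab : a < b) :
    ∃ c, a ≤ c ∧ c < b ∧ ∀ t ∈ Ioo c b, t ∉ S := by
  obtain ⟨c, h1, h2, h3⟩ := exists_free_right (S.image (fun t => -t)) (-b) (-a) (by linarith)
  refine ⟨-c, by linarith, by linarith, fun t ht hS => h3 (-t) ⟨by linarith [ht.2], by linarith [ht.1]⟩ ?_⟩
  exact Finset.mem_image_of_mem _ hS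

theorem exists_differentiableAt_off_finset {γ : ℝ → E} {S : Finset ℝ}
    (hS : ∀ a b : ℝ, 0 ≤ a → a < b → b ≤ 1 → (∀ t ∈ Ioo a b, t ∉ S) → ContDiffOn ℝ ∞ γ (Icc a b))
    {t : ℝ} (ht : t ∈ Ioo (0 : ℝ) 1) (htS : t ∉ S) : DifferentiableAt ℝ γ t := by
  obtain ⟨c, hc1, hc2, hc⟩ := exists_free_right S t 1 ht.2
  obtain ⟨b, hb1, hb2, hb⟩ := exists_free_left S 0 t ht.1
  have := hS b c hb1 (hb2.trans hc1) hc2 fun s hs => by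
    rcases lt_trichotomy s t with h | h | h
    · exact hb s ⟨hs.1, h⟩
    · exact h ▸ htS
    · exact hc s ⟨h, hs.2⟩
  exact ((this t ⟨hb2.le, hc1.le⟩).contDiffAt (Icc_mem_nhds hb2 hc1)).differentiableAt (by simp)

/-- A piecewise smooth curve has finite length. -/
theorem IsPiecewiseSmoothCurve.curveLength_lt_top {M : Set E} {g : E → E → E → ℝ}
    (hg : ∀ x ∈ M, ∀ v, ContinuousAt (fun z : E × E => g z.1 z.2 z.2) (x, v)) {γ : ℝ → E}
    (h : IsPiecewiseSmoothCurve M γ) : curveLength g γ < ⊤ := by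
  obtain ⟨h1, h2, S, hS⟩ := h
  have key : ∀ a b : ℝ, a < b → (0 ≤ a → b ≤ 1 →
      ∫⁻ t in Icc a b, ENNReal.ofReal (speed g γ t) < ⊤) := by
    refine rel_of_forall_free (fun a c b hac hcb hR hR' ha hb => ?_) S fun a b hab hf ha hb => ?_
    · rw [← setLIntegral_Icc_add hac.le hcb.le]
      exact ENNReal.add_lt_top.2 ⟨hR ha (hcb.le.trans hb), hR' (ha.trans hac.le) hb⟩
    · have hd := hS a b ha hab hb hf
      have hc : ContinuousOn (fun t => (γ t, derivWithin γ (Icc a b) t)) (Icc a b) :=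
        hd.continuousOn.prodMk (hd.continuousOn_derivWithin (uniqueDiffOn_Icc hab) (by simp))
      have hc' : ContinuousOn (fun t => √(g (γ t) (derivWithin γ (Icc a b) t)
          (derivWithin γ (Icc a b) t))) (Icc a b) := fun t ht =>
        Real.continuous_sqrt.continuousAt.comp_continuousWithinAt
          (ContinuousAt.comp_continuousWithinAt (g := fun z : E × E => g z.1 z.2 z.2)
            (f := fun t => (γ t, derivWithin γ (Icc a b) t)) (hg _ (h2 t ⟨ha.trans ht.1, ht.2.trans hb⟩) _) (hc t ht))
      rw [setLIntegral_Icc_congr (h := fun t => ENNReal.ofReal (√(g (γ t) (derivWithin γ (Icc a b) t)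
          (derivWithin γ (Icc a b) t)))) ∅ fun t ht _ => by
        rw [speed, derivWithin_of_mem_nhds (Icc_mem_nhds ht.1 ht.2)]]
      exact hc'.integrableOn_Icc.lintegral_lt_top
  exact key 0 1 one_pos le_rfl le_rfl

/-- The length of a piece of a curve of constant speed. -/
theorem setLIntegral_speed_of_const {M : Set E} {g : E → E → E → ℝ} {γ : ℝ → E}
    (h : IsPiecewiseSmoothCurve M γ) {c : ℝ}
    (hc : ∀ t ∈ Ioo (0 : ℝ) 1, DifferentiableAt ℝ γ t → speed g γ t = c) {a b : ℝ} (ha : 0 ≤ a)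
    (hb : b ≤ 1) :
    ∫⁻ t in Icc a b, ENNReal.ofReal (speed g γ t) = ENNReal.ofReal c * ENNReal.ofReal (b - a) := by
  obtain ⟨h1, h2, S, hS⟩ := h
  rw [setLIntegral_Icc_congr (h := fun _ => ENNReal.ofReal c) S fun t ht htS => ?_]
  · simp
  · have ht' : t ∈ Ioo (0 : ℝ) 1 := ⟨ha.trans_lt ht.1, ht.2.trans_le hb⟩
    rw [hc t ht' (exists_differentiableAt_off_finset hS ht' htS)]

theorem curveLength_of_const {M : Set E} {g : E → E → E → ℝ} {γ : ℝ → E}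
    (h : IsPiecewiseSmoothCurve M γ) {c : ℝ}
    (hc : ∀ t ∈ Ioo (0 : ℝ) 1, DifferentiableAt ℝ γ t → speed g γ t = c) :
    curveLength g γ = ENNReal.ofReal c := by
  rw [curveLength, setLIntegral_speed_of_const h hc le_rfl le_rfl]
  simp

/-- The constant speed of a curve is the norm of its initial velocity. -/
theorem const_speed_eq {M : Set E} {g : E → E → E → ℝ}
    (hg : ∀ x ∈ M, ∀ v, ContinuousAt (fun z : E × E => g z.1 z.2 z.2) (x, v)) {γ : ℝ → E}
    (h : IsPiecewiseSmoothCurve M γ) {c : ℝ}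
    (hc : ∀ t ∈ Ioo (0 : ℝ) 1, DifferentiableAt ℝ γ t → speed g γ t = c) {v : E}
    (hv : HasDerivWithinAt γ v (Icc 0 1) 0) : c = √(g (γ 0) v v) := by
  obtain ⟨h1, h2, S, hS⟩ := h
  obtain ⟨b, hb0, hb1, hb⟩ := exists_free_right S 0 1 one_pos
  have hd := hS 0 b le_rfl hb0 hb1 hb
  have hv' : derivWithin γ (Icc 0 b) 0 = v :=
    (hv.mono (Icc_subset_Icc_right hb1)).derivWithin (uniqueDiffOn_Icc hb0 0 ⟨le_rfl, hb0.le⟩)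
  have hc1 : ContinuousWithinAt (fun t => (γ t, derivWithin γ (Icc 0 b) t)) (Icc 0 b) 0 :=
    (hd.continuousOn.prodMk (hd.continuousOn_derivWithin (uniqueDiffOn_Icc hb0) (by simp))) 0
      ⟨le_rfl, hb0.le⟩
  have hc2 : ContinuousWithinAt (fun t => √(g (γ t) (derivWithin γ (Icc 0 b) t)
      (derivWithin γ (Icc 0 b) t))) (Icc 0 b) 0 :=
    Real.continuous_sqrt.continuousAt.comp_continuousWithinAt
      (ContinuousAt.comp_continuousWithinAt (g := fun z : E × E => g z.1 z.2 z.2)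
        (f := fun t => (γ t, derivWithin γ (Icc 0 b) t)) (hg _ (h2 0 ⟨le_rfl, zero_le_one⟩) _) hc1)
  -- The one-sided speed near `0` has two right limits at `0`: the norm of the initial velocity, by
  -- continuity of the metric, and `c`, since it equals `c` on the open interval.
  have ht1 : Tendsto (fun t => √(g (γ t) (derivWithin γ (Icc 0 b) t)
      (derivWithin γ (Icc 0 b) t))) (𝓝[>] 0) (𝓝 (√(g (γ 0) v v))) := by
    rw [← hv']
    rw [← nhdsWithin_Ioo_eq_nhdsGT hb0]
    exact hc2.tendsto.mono_left (nhdsWithin_mono _ Ioo_subset_Icc_self)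
  have ht2 : Tendsto (fun t => √(g (γ t) (derivWithin γ (Icc 0 b) t)
      (derivWithin γ (Icc 0 b) t))) (𝓝[>] 0) (𝓝 c) := by
    refine tendsto_const_nhds.congr' ?_
    rw [← nhdsWithin_Ioo_eq_nhdsGT hb0]
    filter_upwards [self_mem_nhdsWithin] with t ht
    have ht' : t ∈ Ioo (0 : ℝ) 1 := ⟨ht.1, ht.2.trans_le hb1⟩
    rw [← hc t ht' (((hd t ⟨ht.1.le, ht.2.le⟩).contDiffAt
      (Icc_mem_nhds ht.1 ht.2)).differentiableAt (by simp)), speed,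
      derivWithin_of_mem_nhds (Icc_mem_nhds ht.1 ht.2)]
  exact tendsto_nhds_unique ht2 ht1

theorem IsVariation.isPiecewiseSmoothCurve {M : Set E} {γ : ℝ → E} {Γ : ℝ → ℝ → E}
    (h : IsVariation M γ Γ) : ∀ᶠ s in 𝓝 0,
      IsPiecewiseSmoothCurve M (Γ s) ∧ Γ s 0 = γ 0 ∧ Γ s 1 = γ 1 := by
  obtain ⟨-, ε, hε, h1, h2, h3, S, hS⟩ := h
  filter_upwards [Ioo_mem_nhds (neg_lt_zero.2 hε) hε] with s hs
  refine ⟨⟨?_, h2 s hs, S, fun a b ha hab hb hf => ?_⟩, h1 s hs⟩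
  · exact h3.comp (f := fun t => (s, t)) (by fun_prop) fun t ht => ⟨hs, ht⟩
  · exact (hS a b ha hab hb hf).comp (f := fun t => (s, t)) (by fun_prop) fun t ht => ⟨hs, ht⟩

/-- A curve of constant speed that minimizes the length is a geodesic. -/
theorem isGeodesic_of_minimizing {M : Set E} {g : E → E → E → ℝ}
    (hg : ∀ x ∈ M, ∀ v, ContinuousAt (fun z : E × E => g z.1 z.2 z.2) (x, v)) {γ : ℝ → E}
    (h : IsPiecewiseSmoothCurve M γ) {c : ℝ}
    (hc : ∀ t ∈ Ioo (0 : ℝ) 1, DifferentiableAt ℝ γ t → speed g γ t = c)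
    (hmin : curveLength g γ = intrinsicDist M g (γ 0) (γ 1)) : IsGeodesic M g γ := by
  refine ⟨h, ⟨c, hc⟩, fun Γ hΓ δ hδ => ?_⟩
  refine IsLocalMin.hasDerivAt_eq_zero ?_ hδ
  filter_upwards [hΓ.isPiecewiseSmoothCurve] with s hs
  -- Finiteness matters here: `toReal` sends `⊤` to `0`, so a competitor of infinite length would
  -- break the comparison.
  refine ENNReal.toReal_mono (hs.1.curveLength_lt_top hg).ne ?_
  rw [show curveLength g (Γ 0) = curveLength g γ from setLIntegral_speed_congr fun t ht => hΓ.1 t ht,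
    hmin]
  exact iInf₂_le (f := fun (β : ℝ → E) (_ : IsPiecewiseSmoothCurve M β ∧ β 0 = γ 0 ∧ β 1 = γ 1) =>
    curveLength g β) (Γ s) hs

/-- The logarithm consists of the initial velocities of the minimizing curves of constant speed. -/
theorem mem_logSet_iff {M : Set E} {g : E → E → E → ℝ}
    (hg : ∀ x ∈ M, ∀ v, ContinuousAt (fun z : E × E => g z.1 z.2 z.2) (x, v)) {x y v : E} :
    v ∈ logSet M g x y ↔ ∃ γ : ℝ → E, IsPiecewiseSmoothCurve M γ ∧ γ 0 = x ∧ γ 1 = y ∧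
      HasDerivWithinAt γ v (Icc 0 1) 0 ∧
      ∃ c : ℝ, (∀ t ∈ Ioo (0 : ℝ) 1, DifferentiableAt ℝ γ t → speed g γ t = c) ∧
        ENNReal.ofReal c = intrinsicDist M g x y := by
  constructor
  · rintro ⟨⟨γ, ⟨h1, ⟨c, hc⟩, -⟩, rfl, h3, rfl⟩, h5⟩
    exact ⟨γ, h1, rfl, rfl, h3, c, hc, by rw [const_speed_eq hg h1 hc h3, h5]⟩
  · rintro ⟨γ, h1, rfl, rfl, h3, c, hc, h5⟩
    refine ⟨⟨γ, isGeodesic_of_minimizing hg h1 hc ?_, rfl, h3, rfl⟩, ?_⟩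
    · rw [curveLength_of_const h1 hc, h5]
    · rw [← const_speed_eq hg h1 hc h3, h5]

end Curves

end SegreVeronese

namespace SegreVeronese

open MeasureTheory Set Filter Topology InnerProductGeometry

/-! ### Comparison with the Euclidean plane: lower bounds for lengths. -/

section LowerBound

variable {d : ℕ}

/-- Only the part of `x` orthogonal to `u` pairs with `w`, and its length is the sine of the angle.
This cancels the denominator in the derivative of `arccos`, so an angle changes no faster than the
point moves. -/
theorem abs_inner_le_of_orthogonal {V : Type*} [NormedAddCommGroup V] [InnerProductSpace ℝ V]
    {x u w : V} (hx : ‖x‖ = 1) (hu : ‖u‖ = 1) (huw : inner ℝ u w = 0) :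
    |inner ℝ x w| ≤ √(1 - inner ℝ x u ^ 2) * ‖w‖ := by
  have h1 : inner ℝ x w = inner ℝ (x - (inner ℝ x u : ℝ) • u) w := by
    rw [inner_sub_left, real_inner_smul_left, huw]; ring
  have h2 : ‖x - (inner ℝ x u : ℝ) • u‖ = √(1 - inner ℝ x u ^ 2) := by
    rw [eq_comm, Real.sqrt_eq_iff_eq_sq _ (norm_nonneg _), norm_sub_sq_real, real_inner_smul_right,
      norm_smul, hx, hu, Real.norm_eq_abs, mul_pow, sq_abs]
    · ring
    · have := abs_real_inner_le_norm x u
      rw [hx, hu, mul_one] at this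
      nlinarith [sq_abs (inner ℝ x u : ℝ), abs_nonneg (inner ℝ x u : ℝ)]
  rw [h1, ← h2]
  exact abs_real_inner_le_norm _ _

theorem inner_mem_Icc {V : Type*} [NormedAddCommGroup V] [InnerProductSpace ℝ V]
    {x u : V} (hx : ‖x‖ = 1) (hu : ‖u‖ = 1) : (inner ℝ x u : ℝ) ∈ Icc (-1 : ℝ) 1 := by
  have := abs_real_inner_le_norm x u
  rw [hx, hu, mul_one] at this
  exact abs_le.1 this

/-- The velocity of a curve in a sphere is orthogonal to the position. -/
theorem inner_eq_zero_of_norm_eq_one {V : Type*} [NormedAddCommGroup V] [InnerProductSpace ℝ V]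
    {u : ℝ → V} {w : V} {s : Set ℝ} {t : ℝ} (hu : HasDerivWithinAt u w s t)
    (hs : UniqueDiffWithinAt ℝ s t) (hts : t ∈ s) (h : ∀ x ∈ s, ‖u x‖ = 1) :
    inner ℝ (u t) w = 0 := by
  have h1 := hu.inner ℝ hu
  have h2 : HasDerivWithinAt (fun x => inner ℝ (u x) (u x)) (0 : ℝ) s t :=
    (hasDerivWithinAt_const t s (1 : ℝ)).congr (fun x hx => by simp [h x hx])
      (by simp [h t hts])
  have h3 := hs.eq_deriv _ h1 h2
  linarith [real_inner_comm w (u t)]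

theorem hasDerivWithinAt_fst_snd {n : Fin d → ℕ} {γ : ℝ → PreSpace n} {w : PreSpace n} {s : Set ℝ}
    {t : ℝ} : HasDerivWithinAt γ w s t ↔ HasDerivWithinAt (fun x => (γ x).1) w.1 s t ∧
      ∀ i, HasDerivWithinAt (fun x => (γ x).2 i) (w.2 i) s t := by
  refine ⟨fun h => ⟨?_, fun i => ?_⟩, fun h => ?_⟩
  · exact (ContinuousLinearMap.fst ℝ ℝ _).hasFDerivAt.comp_hasDerivWithinAt t h
  · have := (ContinuousLinearMap.snd ℝ ℝ ((i : Fin d) → EuclideanSpace ℝ (Fin (n i)))).hasFDerivAt.comp_hasDerivWithinAt t h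
    exact hasDerivWithinAt_pi.1 this i
  · exact h.1.prodMk (hasDerivWithinAt_pi.2 h.2)

theorem tangent_of_hasDerivWithinAt {n : Fin d → ℕ} {γ : ℝ → PreSpace n} {w : PreSpace n}
    {s : Set ℝ} {t : ℝ} (hγ : HasDerivWithinAt γ w s t) (hs : UniqueDiffWithinAt ℝ s t) (hts : t ∈ s)
    (h : ∀ x ∈ s, γ x ∈ preSegreVeronese n) (i : Fin d) : inner ℝ ((γ t).2 i) (w.2 i) = 0 :=
  inner_eq_zero_of_norm_eq_one ((hasDerivWithinAt_fst_snd.1 hγ).2 i) hs hts fun x hx => (h x hx).2 i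

/-- A planar curve whose speed is at most that of the curve `γ` in the pre-Segre–Veronese manifold:
the radius is that of `γ`, and the argument is a combination of (regularized) angles. -/
def planarCurve {n : Fin d → ℕ} (α c : ℝ) (w : Fin d → ℝ) (p : PreSpace n) (γ : ℝ → PreSpace n)
    (t : ℝ) : ℂ :=
  (γ t).1 * Complex.exp
    ((α * ∑ i, w i * Real.arccos (c * inner ℝ (p.2 i) ((γ t).2 i)) : ℝ) * Complex.I)

/-- The factor `c < 1` keeps the argument of `arccos` strictly inside `(-1, 1)`, even when a
component meets or is antipodal to that of `p`. -/
theorem contDiffOn_planarCurve {n : Fin d → ℕ} (α : ℝ) {c : ℝ} (hc0 : 0 ≤ c) (hc1 : c < 1)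
    (w : Fin d → ℝ) {p : PreSpace n} (hp : p ∈ preSegreVeronese n) {γ : ℝ → PreSpace n} {s : Set ℝ}
    (hγ : ContDiffOn ℝ ∞ γ s) (h : ∀ t ∈ s, γ t ∈ preSegreVeronese n) :
    ContDiffOn ℝ ∞ (planarCurve α c w p γ) s := by
  have h1 : ContDiffOn ℝ ∞ (fun t => (γ t).1) s := contDiff_fst.comp_contDiffOn hγ
  have h2 : ∀ i, ContDiffOn ℝ ∞ (fun t => (γ t).2 i) s := fun i =>
    contDiffOn_pi.1 (contDiff_snd.comp_contDiffOn hγ) i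
  have h3 : ∀ i, ContDiffOn ℝ ∞ (fun t => Real.arccos (c * inner ℝ (p.2 i) ((γ t).2 i))) s := by
    intro i t ht
    have hx := inner_mem_Icc (hp.2 i) ((h t ht).2 i)
    refine (Real.contDiffAt_arccos ?_ ?_).comp_contDiffWithinAt t
      (contDiffWithinAt_const.mul (contDiffWithinAt_const.inner ℝ (h2 i t ht)))
    · nlinarith [hx.1, hx.2]
    · nlinarith [hx.1, hx.2]
  unfold planarCurve
  refine (Complex.ofRealCLM.contDiff.comp_contDiffOn h1).mul (Complex.contDiff_exp.comp_contDiffOn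
    ((Complex.ofRealCLM.contDiff.comp_contDiffOn ?_).mul contDiffOn_const))
  exact contDiffOn_const.mul (ContDiffOn.sum fun i _ => contDiffOn_const.mul (h3 i))

/-- The radial parts agree. Each regularised angle has derivative at most `‖v.2 i‖`, and
Cauchy–Schwarz with the factors `w i ^ 2 / k i` and `k i * ‖v.2 i‖ ^ 2` bounds the angular part. -/
theorem norm_deriv_planarCurve_le {n k : Fin d → ℕ} (hk : ∀ i, 1 ≤ k i) (α : ℝ) {c : ℝ} (hc0 : 0 ≤ c)
    (hc1 : c < 1) {w : Fin d → ℝ} (hw0 : ∀ i, 0 ≤ w i) (hw1 : ∑ i, w i ^ 2 / k i ≤ 1)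
    {p : PreSpace n} (hp : p ∈ preSegreVeronese n) {γ : ℝ → PreSpace n} {t : ℝ}
    (hγ : DifferentiableAt ℝ γ t) (h : ∀ᶠ s in 𝓝 t, γ s ∈ preSegreVeronese n) :
    ‖deriv (planarCurve α c w p γ) t‖ ≤ speed (preMetric n k α) γ t := by
  obtain ⟨s, hs, hso, hts⟩ := eventually_nhds_iff.1 h
  have hd := (hγ.hasDerivAt.hasDerivWithinAt (s := s))
  have htan := tangent_of_hasDerivWithinAt hd (hso.uniqueDiffWithinAt hts) hts hs
  set v := deriv γ t with hv
  have hd' := hasDerivWithinAt_fst_snd.1 (hasDerivWithinAt_univ.2 hγ.hasDerivAt)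
  simp only [hasDerivWithinAt_univ] at hd'
  obtain ⟨hd1, hd2⟩ := hd'
  have hγt := hs t hts
  have ha : ∀ i, ∃ a' : ℝ, HasDerivAt (fun t => Real.arccos (c * inner ℝ (p.2 i) ((γ t).2 i))) a' t ∧
      |a'| ≤ ‖v.2 i‖ := by
    intro i
    set x : ℝ := inner ℝ (p.2 i) ((γ t).2 i) with hx
    have hxm := inner_mem_Icc (hp.2 i) (hγt.2 i)
    rw [← hx] at hxm
    have hcx : 0 < 1 - (c * x) ^ 2 := by
      nlinarith [hxm.1, hxm.2, mul_nonneg hc0 hc0, sq_nonneg x, mul_nonneg (sub_nonneg.2 hxm.2) (sub_nonneg.2 hxm.1)]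
    have hin : HasDerivAt (fun t => c * inner ℝ (p.2 i) ((γ t).2 i)) (c * inner ℝ (p.2 i) (v.2 i)) t := by
      have := ((hasDerivAt_const t (p.2 i)).inner ℝ (hd2 i)).const_mul c
      simpa using this
    have := (Real.hasDerivAt_arccos (x := c * x) (by nlinarith [hxm.1, hxm.2])
      (by nlinarith [hxm.1, hxm.2])).comp t hin
    refine ⟨_, this, ?_⟩
    rw [abs_mul, abs_neg, abs_mul, abs_of_nonneg hc0, abs_of_nonneg (by positivity), div_mul_eq_mul_div,
      one_mul, div_le_iff₀ (Real.sqrt_pos.2 hcx)]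
    have h1 := abs_inner_le_of_orthogonal (hp.2 i) (hγt.2 i) (htan i)
    rw [← hx] at h1
    calc c * |inner ℝ (p.2 i) (v.2 i)| ≤ 1 * |inner ℝ (p.2 i) (v.2 i)| := by gcongr
      _ ≤ √(1 - x ^ 2) * ‖v.2 i‖ := by rw [one_mul]; exact h1
      _ ≤ √(1 - (c * x) ^ 2) * ‖v.2 i‖ := by
          refine mul_le_mul_of_nonneg_right (Real.sqrt_le_sqrt ?_) (norm_nonneg _)
          rw [mul_pow, sub_le_sub_iff_left]
          exact mul_le_of_le_one_left (sq_nonneg x) (by nlinarith)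
      _ = ‖v.2 i‖ * √(1 - (c * x) ^ 2) := mul_comm _ _
  choose a' ha1 ha2 using ha
  set ψ' : ℝ := α * ∑ i, w i * a' i with hψ'
  have hψ : HasDerivAt (fun t => α * ∑ i, w i * Real.arccos (c * inner ℝ (p.2 i) ((γ t).2 i))) ψ' t :=
    (HasDerivAt.fun_sum fun i _ => (ha1 i).const_mul (w i)).const_mul α
  have hG := hd1.ofReal_comp.mul (hψ.ofReal_comp.mul_const Complex.I).cexp
  have hG' : HasDerivAt (planarCurve α c w p γ) _ t := hG
  rw [hG'.deriv]
  have hbound : (∑ i, w i * a' i) ^ 2 ≤ ∑ i, (k i : ℝ) * inner ℝ (v.2 i) (v.2 i) := by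
    have hkpos : ∀ i, (0 : ℝ) < k i := fun i => by exact_mod_cast hk i
    calc (∑ i, w i * a' i) ^ 2 = |∑ i, w i * a' i| ^ 2 := (sq_abs _).symm
      _ ≤ (∑ i, w i * ‖v.2 i‖) ^ 2 := by
          gcongr
          refine (Finset.abs_sum_le_sum_abs _ _).trans (Finset.sum_le_sum fun i _ => ?_)
          rw [abs_mul, abs_of_nonneg (hw0 i)]
          exact mul_le_mul_of_nonneg_left (ha2 i) (hw0 i)
      _ ≤ (∑ i, w i ^ 2 / k i) * ∑ i, (k i : ℝ) * inner ℝ (v.2 i) (v.2 i) := by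
          refine Finset.sum_sq_le_sum_mul_sum_of_sq_le_mul _ (fun i _ => by positivity)
            (fun i _ => mul_nonneg (hkpos i).le real_inner_self_nonneg) fun i _ => ?_
          rw [real_inner_self_eq_norm_sq]
          have := (hkpos i).ne'
          refine le_of_eq ?_
          field_simp
      _ ≤ _ := mul_le_of_le_one_left
          (Finset.sum_nonneg fun i _ => mul_nonneg (hkpos i).le real_inner_self_nonneg) hw1
  rw [speed]
  refine Real.le_sqrt_of_sq_le ?_
  have hexp : ∀ x : ℝ, ‖Complex.exp (x * Complex.I)‖ = 1 := Complex.norm_exp_ofReal_mul_I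
  have hfac : ∀ (r r' q : ℝ) (e : ℂ), ‖e‖ = 1 → ‖(r' : ℂ) * e + r * (e * (q * Complex.I))‖ ^ 2 =
      r' ^ 2 + r ^ 2 * q ^ 2 := by
    intro r r' q e he
    have : (r' : ℂ) * e + r * (e * (q * Complex.I)) = ((r' : ℂ) + (r * q : ℝ) * Complex.I) * e := by
      push_cast; ring
    rw [this, norm_mul, he, mul_one, Complex.sq_norm, Complex.normSq_add_mul_I]
    ring
  rw [hfac _ _ _ _ (hexp _), preMetric, ← hv]
  have : (γ t).1 ^ 2 * ψ' ^ 2 ≤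
      (α * (γ t).1) ^ 2 * ∑ i, (k i : ℝ) * inner ℝ (v.2 i) (v.2 i) := by
    rw [hψ', mul_pow α, mul_pow α]
    calc _ = α ^ 2 * (γ t).1 ^ 2 * (∑ i, w i * a' i) ^ 2 := by ring
      _ ≤ _ := by gcongr
  nlinarith [this]

theorem planarCurve_sub_le {n k : Fin d → ℕ} (hk : ∀ i, 1 ≤ k i) (α : ℝ) {c : ℝ} (hc0 : 0 ≤ c)
    (hc1 : c < 1) {w : Fin d → ℝ} (hw0 : ∀ i, 0 ≤ w i) (hw1 : ∑ i, w i ^ 2 / k i ≤ 1)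
    {p : PreSpace n} (hp : p ∈ preSegreVeronese n) {γ : ℝ → PreSpace n}
    (hγ : IsPiecewiseSmoothCurve (preSegreVeronese n) γ) {a b : ℝ} (ha : 0 ≤ a) (hab : a < b)
    (hb : b ≤ 1) :
    ENNReal.ofReal ‖planarCurve α c w p γ b - planarCurve α c w p γ a‖ ≤
      ∫⁻ t in Icc a b, ENNReal.ofReal (speed (preMetric n k α) γ t) := by
  obtain ⟨h1, h2, S, hS⟩ := hγ
  have key : ∀ a b : ℝ, a < b → (0 ≤ a → b ≤ 1 →
      ENNReal.ofReal ‖planarCurve α c w p γ b - planarCurve α c w p γ a‖ ≤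
        ∫⁻ t in Icc a b, ENNReal.ofReal (speed (preMetric n k α) γ t)) := by
    refine rel_of_forall_free (fun a x b hax hxb hR hR' ha hb => ?_) S fun a b hab hf ha hb => ?_
    · rw [← setLIntegral_Icc_add hax.le hxb.le]
      refine le_trans ?_ (add_le_add (hR ha (hxb.le.trans hb)) (hR' (ha.trans hax.le) hb))
      rw [← ENNReal.ofReal_add (norm_nonneg _) (norm_nonneg _), add_comm]
      exact ENNReal.ofReal_le_ofReal (norm_sub_le_norm_sub_add_norm_sub _ _ _)
    · have hd := hS a b ha hab hb hf
      have hm : ∀ t ∈ Icc a b, γ t ∈ preSegreVeronese n := fun t ht =>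
        h2 t ⟨ha.trans ht.1, ht.2.trans hb⟩
      have := enorm_sub_le_lintegral_deriv_of_contDiffOn_Icc
        ((contDiffOn_planarCurve α hc0 hc1 w hp hd hm).of_le (by simp)) hab.le
      rw [ofReal_norm]
      refine this.trans ?_
      rw [← restrict_Ioo_eq_restrict_Icc]
      refine setLIntegral_mono_ae' measurableSet_Ioo (Eventually.of_forall fun t ht => ?_)
      rw [← ofReal_norm]
      refine ENNReal.ofReal_le_ofReal (norm_deriv_planarCurve_le hk α hc0 hc1 hw0 hw1 hp ?_ ?_)
      · exact ((hd t ⟨ht.1.le, ht.2.le⟩).contDiffAt (Icc_mem_nhds ht.1 ht.2)).differentiableAt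
          (by simp)
      · filter_upwards [Icc_mem_nhds ht.1 ht.2] with s hs using hm s hs
  exact key a b hab ha hb

theorem angle_eq_arccos {V : Type*} [NormedAddCommGroup V] [InnerProductSpace ℝ V] {x u : V}
    (hx : ‖x‖ = 1) (hu : ‖u‖ = 1) : angle x u = Real.arccos (inner ℝ x u) := by
  simp [angle, hx, hu]

theorem sphericalDist_nonneg {n : Fin d → ℕ} (k : Fin d → ℕ) (p q : PreSpace n) :
    0 ≤ sphericalDist k p q := Real.sqrt_nonneg _

theorem sphericalDist_sq {n : Fin d → ℕ} (k : Fin d → ℕ) (p q : PreSpace n) :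
    sphericalDist k p q ^ 2 = ∑ i, (k i : ℝ) * angle (p.2 i) (q.2 i) ^ 2 :=
  Real.sq_sqrt (Finset.sum_nonneg fun i _ => by positivity)

/-- A lower bound for the length of the pieces of the curves in the pre-Segre–Veronese manifold, by
comparison with the plane. -/
theorem ofReal_norm_sub_le_lintegral_speed {n k : Fin d → ℕ} (hk : ∀ i, 1 ≤ k i) (α : ℝ)
    {γ : ℝ → PreSpace n} (hγ : IsPiecewiseSmoothCurve (preSegreVeronese n) γ) {a b : ℝ} (ha : 0 ≤ a)
    (hab : a < b) (hb : b ≤ 1) {m : ℝ} (hm0 : 0 ≤ m) (hm : m ≤ sphericalDist k (γ a) (γ b)) :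
    ENNReal.ofReal ‖((γ a).1 : ℂ) - (γ b).1 * Complex.exp ((α * m : ℝ) * Complex.I)‖ ≤
      ∫⁻ t in Icc a b, ENNReal.ofReal (speed (preMetric n k α) γ t) := by
  have hkpos : ∀ i, (0 : ℝ) < k i := fun i => by exact_mod_cast hk i
  have hpa := hγ.2.1 a ⟨ha, hab.le.trans hb⟩
  have hpb := hγ.2.1 b ⟨ha.trans hab.le, hb⟩
  set M := sphericalDist k (γ a) (γ b) with hM
  have hM0 : 0 ≤ M := hm0.trans hm
  -- These are the weights of equality in Cauchy–Schwarz, scaled by `m / M`: they satisfy `∑ wᵢ² /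
  -- kᵢ = (m / M)²` and `∑ wᵢ θᵢ = m`. For `M = 0` they are `0` by the division convention, and `m =
  -- 0` as well.
  set w : Fin d → ℝ := fun i => k i * angle ((γ a).2 i) ((γ b).2 i) * m / M ^ 2 with hw
  have hsum : ∑ i, (k i : ℝ) * angle ((γ a).2 i) ((γ b).2 i) ^ 2 = M ^ 2 :=
    (sphericalDist_sq k _ _).symm
  have hw0 : ∀ i, 0 ≤ w i := fun i => by
    have := angle_nonneg ((γ a).2 i) ((γ b).2 i)
    positivity
  have hw1 : ∑ i, w i ^ 2 / k i ≤ 1 := by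
    have : ∀ i, w i ^ 2 / k i = k i * angle ((γ a).2 i) ((γ b).2 i) ^ 2 * (m ^ 2 / M ^ 4) := by
      intro i
      have := (hkpos i).ne'
      simp only [hw]
      field_simp
    simp_rw [this]
    rw [← Finset.sum_mul, hsum, ← mul_div_assoc]
    refine div_le_one_of_le₀ ?_ (by positivity)
    have : m ^ 2 ≤ M ^ 2 := by gcongr
    nlinarith [sq_nonneg M]
  have hwm : ∑ i, w i * angle ((γ a).2 i) ((γ b).2 i) = m := by
    have : ∀ i, w i * angle ((γ a).2 i) ((γ b).2 i) =
        k i * angle ((γ a).2 i) ((γ b).2 i) ^ 2 * (m / M ^ 2) := by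
      intro i
      simp only [hw]
      ring
    simp_rw [this]
    rw [← Finset.sum_mul, hsum]
    rcases hM0.eq_or_lt with h | h
    · have : m = 0 := le_antisymm (h ▸ hm) hm0
      simp [this]
    · field_simp
  have hcont : ∀ t, Continuous fun c : ℝ => planarCurve α c w (γ a) γ t := by
    intro t
    unfold planarCurve
    have := Real.continuous_arccos
    fun_prop
  -- The regularisation is removed by letting `c` tend to `1` from below: the length bound does not
  -- depend on `c`.
  have hlim : Tendsto (fun c => ENNReal.ofReal
      ‖planarCurve α c w (γ a) γ b - planarCurve α c w (γ a) γ a‖) (𝓝[<] 1)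
      (𝓝 (ENNReal.ofReal ‖planarCurve α 1 w (γ a) γ b - planarCurve α 1 w (γ a) γ a‖)) := by
    have : Continuous (fun c => ENNReal.ofReal
      ‖planarCurve α c w (γ a) γ b - planarCurve α c w (γ a) γ a‖) :=
      ENNReal.continuous_ofReal.comp ((hcont b).sub (hcont a)).norm
    exact this.continuousAt.tendsto.mono_left nhdsWithin_le_nhds
  have h1 : planarCurve α 1 w (γ a) γ a = (γ a).1 := by
    simp [planarCurve, hpa.2]
  have h2 : planarCurve α 1 w (γ a) γ b = (γ b).1 * Complex.exp ((α * m : ℝ) * Complex.I) := by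
    simp only [planarCurve, one_mul, ← angle_eq_arccos (hpa.2 _) (hpb.2 _), hwm]
  rw [h1, h2, norm_sub_rev] at hlim
  refine le_of_tendsto hlim ?_
  filter_upwards [Ioo_mem_nhdsLT (zero_lt_one' ℝ)] with c hc
  exact planarCurve_sub_le hk α hc.1.le hc.2 hw0 hw1 hpa hγ ha hab hb

end LowerBound

end SegreVeronese

namespace SegreVeronese

open MeasureTheory Set Filter Topology InnerProductGeometry

/-! ### The lifted planar chord and the distance on the pre-Segre–Veronese manifold. -/

section Model

/-- The segment in the plane between the points with polar coordinates `(l, 0)` and `(m, φ)`. -/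
def planarChord (l m φ t : ℝ) : ℂ := (1 - t) * l + t * (m * Complex.exp (φ * Complex.I))

/-- For `0 < φ` the chord enters the open upper half plane after its positive real start; for `φ =
0` it stays on the positive axis. The principal logarithm is therefore smooth along it and reads off
log-radius and angle. -/
theorem planarChord_mem_slitPlane {l m φ t : ℝ} (hl : 0 < l) (hm : 0 < m) (hφ0 : 0 ≤ φ)
    (hφ : φ < Real.pi) (ht : t ∈ Icc (0 : ℝ) 1) : planarChord l m φ t ∈ Complex.slitPlane := by
  rw [Complex.mem_slitPlane_iff]
  have hre : (planarChord l m φ t).re = (1 - t) * l + t * (m * Real.cos φ) := by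
    simp [planarChord, Complex.exp_ofReal_mul_I_re, Complex.exp_ofReal_mul_I_im]
  have him : (planarChord l m φ t).im = t * (m * Real.sin φ) := by
    simp [planarChord, Complex.exp_ofReal_mul_I_re, Complex.exp_ofReal_mul_I_im]
  rw [hre, him]
  rcases ht.1.eq_or_lt with rfl | ht0
  · left; simpa using hl
  rcases hφ0.eq_or_lt with rfl | hφ0
  · left
    rw [Real.cos_zero, mul_one]
    have : 0 ≤ (1 - t) * l := mul_nonneg (by linarith [ht.2]) hl.le
    positivity
  · right
    have := Real.sin_pos_of_pos_of_lt_pi hφ0 hφ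
    positivity

theorem planarChord_zero (l m φ : ℝ) : planarChord l m φ 0 = l := by simp [planarChord]

theorem planarChord_one (l m φ : ℝ) :
    planarChord l m φ 1 = m * Complex.exp (φ * Complex.I) := by simp [planarChord]

theorem hasDerivAt_planarChord (l m φ t : ℝ) :
    HasDerivAt (planarChord l m φ) (m * Complex.exp (φ * Complex.I) - l) t := by
  have h1 : HasDerivAt (fun t : ℝ => (t : ℂ)) 1 t := Complex.ofRealCLM.hasDerivAt
  have := ((h1.const_sub 1).mul_const (l : ℂ)).add (h1.mul_const (m * Complex.exp (φ * Complex.I)))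
  refine this.congr_deriv ?_
  ring

theorem contDiff_planarChord (l m φ : ℝ) : ContDiff ℝ ∞ (planarChord l m φ) := by
  have h1 : ContDiff ℝ ∞ (fun t : ℝ => (t : ℂ)) := Complex.ofRealCLM.contDiff
  unfold planarChord
  fun_prop

theorem log_polar {m φ : ℝ} (hm : 0 < m) (hφ0 : 0 ≤ φ) (hφ : φ < Real.pi) :
    (Complex.log (m * Complex.exp (φ * Complex.I))).re = Real.log m ∧
      (Complex.log (m * Complex.exp (φ * Complex.I))).im = φ := by
  constructor
  · rw [Complex.log_re]
    simp [abs_of_pos hm]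
  · rw [Complex.log_im, Complex.exp_mul_I, Complex.arg_mul_cos_add_sin_mul_I hm]
    exact ⟨by linarith [Real.pi_pos], hφ.le⟩

variable {d : ℕ} {n : Fin d → ℕ}

/-- `e` consists of initial directions of great circles from the components of `p` to those of `q`. -/
structure IsDirection (p q : PreSpace n) (e : (i : Fin d) → EuclideanSpace ℝ (Fin (n i))) : Prop where
  inner_eq_zero : ∀ i, inner ℝ (p.2 i) (e i) = 0
  norm_eq_one : ∀ i, angle (p.2 i) (q.2 i) ≠ 0 → ‖e i‖ = 1
  eq_add : ∀ i, q.2 i = Real.cos (angle (p.2 i) (q.2 i)) • p.2 i +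
    Real.sin (angle (p.2 i) (q.2 i)) • e i

/-- The distance in the plane between the points with polar coordinates `(l, 0)` and `(m, α M)`, where
`l` and `m` are the radii of `p` and `q`, and `M` is their weighted spherical distance. -/
def coneDist (k : Fin d → ℕ) (α : ℝ) (p q : PreSpace n) : ℝ :=
  ‖(p.1 : ℂ) - q.1 * Complex.exp ((α * sphericalDist k p q : ℝ) * Complex.I)‖

/-- The geodesic from `p` to `q` whose angular components have the directions `e`. -/
def coneGeodesic (k : Fin d → ℕ) (α : ℝ) (p q : PreSpace n)
    (e : (i : Fin d) → EuclideanSpace ℝ (Fin (n i))) (t : ℝ) : PreSpace n :=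
  let z := Complex.log (planarChord p.1 q.1 (α * sphericalDist k p q) t)
  (Real.exp z.re, fun i =>
    Real.cos (z.im / (α * sphericalDist k p q) * angle (p.2 i) (q.2 i)) • p.2 i +
      Real.sin (z.im / (α * sphericalDist k p q) * angle (p.2 i) (q.2 i)) • e i)

theorem norm_rotation {V : Type*} [NormedAddCommGroup V] [InnerProductSpace ℝ V] {u e : V}
    (hu : ‖u‖ = 1) (he : ‖e‖ = 1) (h : inner ℝ u e = 0) {a b : ℝ} (hab : a ^ 2 + b ^ 2 = 1) :
    ‖a • u + b • e‖ = 1 := by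
  have : ‖a • u + b • e‖ ^ 2 = 1 := by
    rw [norm_add_sq_real, real_inner_smul_left, real_inner_smul_right, h, norm_smul, norm_smul, hu,
      he, Real.norm_eq_abs, Real.norm_eq_abs, mul_one, mul_one, sq_abs, sq_abs, ← hab]
    ring
  nlinarith [norm_nonneg (a • u + b • e)]

section Hyp

variable {k : Fin d → ℕ} {α : ℝ} (hα : 0 < α) {p q : PreSpace n} (hp : p ∈ preSegreVeronese n)
  (hq : q ∈ preSegreVeronese n) (hpq : IsCompatible k α p q)
  {e : (i : Fin d) → EuclideanSpace ℝ (Fin (n i))} (he : IsDirection p q e)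

include hα hpq in
theorem mul_sphericalDist_lt_pi : α * sphericalDist k p q < Real.pi := by
  have := mul_lt_mul_of_pos_left hpq hα
  rwa [mul_inv_cancel_left₀ hα.ne'] at this

theorem angle_eq_zero_of_sphericalDist_eq_zero (hk : ∀ i, 1 ≤ k i) (h : sphericalDist k p q = 0)
    (i : Fin d) : angle (p.2 i) (q.2 i) = 0 := by
  have h1 := sphericalDist_sq k p q
  rw [h, zero_pow two_ne_zero, eq_comm,
    Finset.sum_eq_zero_iff_of_nonneg (fun i _ => by positivity)] at h1
  have h2 := h1 i (Finset.mem_univ i)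
  have : (k i : ℝ) ≠ 0 := by
    have := hk i
    positivity
  simpa [this] using h2

include hα in
-- For `M = 0` the quotient is `0` rather than `1`, which is harmless because every angle vanishes.
theorem div_mul_angle (hk : ∀ i, 1 ≤ k i) (i : Fin d) :
    α * sphericalDist k p q / (α * sphericalDist k p q) * angle (p.2 i) (q.2 i) =
      angle (p.2 i) (q.2 i) := by
  by_cases h : sphericalDist k p q = 0
  · simp [angle_eq_zero_of_sphericalDist_eq_zero hk h i]
  · rw [div_self (mul_ne_zero hα.ne' h), one_mul]

include hp he in
theorem coneGeodesic_mem (t : ℝ) : coneGeodesic k α p q e t ∈ preSegreVeronese n := by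
  refine ⟨Real.exp_pos _, fun i => ?_⟩
  by_cases h : angle (p.2 i) (q.2 i) = 0
  · simp [coneGeodesic, h, hp.2 i]
  · exact norm_rotation (hp.2 i) (he.norm_eq_one i h) (he.inner_eq_zero i) (Real.cos_sq_add_sin_sq _)

include hp in
theorem coneGeodesic_zero : coneGeodesic k α p q e 0 = p := by
  have h : Complex.log (p.1 : ℂ) = (Real.log p.1 : ℝ) := (Complex.ofReal_log hp.1.le).symm
  ext i
  · simp only [coneGeodesic, planarChord_zero, h, Complex.ofReal_re]
    exact Real.exp_log hp.1
  · simp [coneGeodesic, planarChord_zero, h]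

include hα hq hpq he in
theorem coneGeodesic_one (hk : ∀ i, 1 ≤ k i) : coneGeodesic k α p q e 1 = q := by
  have hφ := mul_sphericalDist_lt_pi hα hpq
  have hφ0 : 0 ≤ α * sphericalDist k p q := mul_nonneg hα.le (sphericalDist_nonneg k p q)
  obtain ⟨h1, h2⟩ := log_polar hq.1 hφ0 hφ
  refine Prod.ext ?_ (funext fun i => ?_)
  · simp only [coneGeodesic, planarChord_one, h1]
    exact Real.exp_log hq.1
  · simp only [coneGeodesic, planarChord_one, h2, div_mul_angle hα hk]
    exact (he.eq_add i).symm

include hα hp hq hpq in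
theorem contDiffOn_coneGeodesic : ContDiffOn ℝ ∞ (coneGeodesic k α p q e) (Icc 0 1) := by
  intro t ht
  have hφ := mul_sphericalDist_lt_pi hα hpq
  have hφ0 : 0 ≤ α * sphericalDist k p q := mul_nonneg hα.le (sphericalDist_nonneg k p q)
  have hlog : ContDiffAt ℝ ∞ (fun t => Complex.log (planarChord p.1 q.1 (α * sphericalDist k p q) t)) t :=
    ((Complex.contDiffAt_log (planarChord_mem_slitPlane hp.1 hq.1 hφ0 hφ ht)).restrict_scalars ℝ).comp t
      (contDiff_planarChord _ _ _).contDiffAt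
  have hre := Complex.reCLM.contDiff.contDiffAt.comp t hlog
  have him := Complex.imCLM.contDiff.contDiffAt.comp t hlog
  refine ContDiffAt.contDiffWithinAt ?_
  refine (Real.contDiff_exp.contDiffAt.comp t hre).prodMk (contDiffAt_pi.2 fun i => ?_)
  have hτ := (him.div_const (α * sphericalDist k p q)).mul
    (contDiffAt_const (c := angle (p.2 i) (q.2 i)))
  exact ((Real.contDiff_cos.contDiffAt.comp t hτ).smul contDiffAt_const).add
    ((Real.contDiff_sin.contDiffAt.comp t hτ).smul contDiffAt_const)

include hα hp hq hpq he in
theorem isPiecewiseSmoothCurve_coneGeodesic :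
    IsPiecewiseSmoothCurve (preSegreVeronese n) (coneGeodesic k α p q e) := by
  have h := contDiffOn_coneGeodesic (e := e) hα hp hq hpq
  exact ⟨h.continuousOn, fun t _ => coneGeodesic_mem hp he t, ∅,
    fun a b ha _ hb _ => h.mono (Icc_subset_Icc ha hb)⟩

/-- The velocity of `coneGeodesic`. -/
def coneVelocity (k : Fin d → ℕ) (α : ℝ) (p q : PreSpace n)
    (e : (i : Fin d) → EuclideanSpace ℝ (Fin (n i))) (t : ℝ) : PreSpace n :=
  let φ := α * sphericalDist k p q
  let z := Complex.log (planarChord p.1 q.1 φ t)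
  let D := (q.1 * Complex.exp (φ * Complex.I) - p.1) / planarChord p.1 q.1 φ t
  (Real.exp z.re * D.re, fun i =>
    (D.im / φ * angle (p.2 i) (q.2 i)) • ((-Real.sin (z.im / φ * angle (p.2 i) (q.2 i))) • p.2 i +
      Real.cos (z.im / φ * angle (p.2 i) (q.2 i)) • e i))

include hα hp hq hpq in
theorem hasDerivAt_coneGeodesic {t : ℝ} (ht : t ∈ Icc (0 : ℝ) 1) :
    HasDerivAt (coneGeodesic k α p q e) (coneVelocity k α p q e t) t := by
  have hφ := mul_sphericalDist_lt_pi hα hpq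
  have hφ0 : 0 ≤ α * sphericalDist k p q := mul_nonneg hα.le (sphericalDist_nonneg k p q)
  have hlog := (hasDerivAt_planarChord p.1 q.1 (α * sphericalDist k p q) t).clog_real
    (planarChord_mem_slitPlane hp.1 hq.1 hφ0 hφ ht)
  have hre := Complex.reCLM.hasFDerivAt.comp_hasDerivAt t hlog
  have him := Complex.imCLM.hasFDerivAt.comp_hasDerivAt t hlog
  refine HasDerivAt.prodMk hre.exp (hasDerivAt_pi.2 fun i => ?_)
  have hτ := (him.div_const (α * sphericalDist k p q)).mul_const (angle (p.2 i) (q.2 i))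
  refine ((hτ.cos.smul_const (p.2 i)).add (hτ.sin.smul_const (e i))).congr_deriv ?_
  simp only [Function.comp_apply, Complex.imCLM_apply, smul_add, smul_smul]
  congr 2 <;> ring

include hα hp hq hpq he in
-- With `D = z' / z` the logarithmic derivative of the chord, the radial speed is `‖z‖ * D.re` and
-- the weighted angular speed is `‖z‖ * |D.im|`. Together they give `‖D * z‖ = ‖z'‖`, which is
-- constant along a chord.
theorem speed_coneGeodesic {t : ℝ} (ht : t ∈ Icc (0 : ℝ) 1) :
    speed (preMetric n k α) (coneGeodesic k α p q e) t = coneDist k α p q := by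
  have hφ := mul_sphericalDist_lt_pi hα hpq
  have hM0 := sphericalDist_nonneg k p q
  have hφ0 : 0 ≤ α * sphericalDist k p q := mul_nonneg hα.le hM0
  have hz := planarChord_mem_slitPlane hp.1 hq.1 hφ0 hφ ht
  have hz0 := Complex.slitPlane_ne_zero hz
  rw [speed, (hasDerivAt_coneGeodesic hα hp hq hpq ht).deriv, coneDist, norm_sub_rev]
  rw [Real.sqrt_eq_iff_eq_sq]
  rotate_left
  · have : 0 ≤ ∑ i, (k i : ℝ) * inner ℝ ((coneVelocity k α p q e t).2 i)
        ((coneVelocity k α p q e t).2 i) :=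
      Finset.sum_nonneg fun i _ => mul_nonneg (Nat.cast_nonneg _) real_inner_self_nonneg
    unfold preMetric
    have := mul_self_nonneg (coneVelocity k α p q e t).1
    positivity
  · exact norm_nonneg _
  set φ := α * sphericalDist k p q with hφdef
  set z := planarChord p.1 q.1 φ t with hzdef
  set D := (q.1 * Complex.exp (φ * Complex.I) - p.1) / z with hD
  have hr : Real.exp (Complex.log z).re = ‖z‖ := by
    rw [Complex.log_re, Real.exp_log (norm_pos_iff.2 hz0)]
  have hin : ∀ i, inner ℝ ((coneVelocity k α p q e t).2 i) ((coneVelocity k α p q e t).2 i) =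
      (D.im / φ) ^ 2 * angle (p.2 i) (q.2 i) ^ 2 := by
    intro i
    rw [real_inner_self_eq_norm_sq]
    simp only [coneVelocity]
    rw [← hφdef, ← hzdef, ← hD, norm_smul, mul_pow, Real.norm_eq_abs, sq_abs, mul_pow]
    by_cases h : angle (p.2 i) (q.2 i) = 0
    · simp [h]
    · rw [norm_rotation (hp.2 i) (he.norm_eq_one i h) (he.inner_eq_zero i)
        (by rw [neg_sq]; exact Real.sin_sq_add_cos_sq _)]
      ring
  have hsum : α ^ 2 * ∑ i, (k i : ℝ) * inner ℝ ((coneVelocity k α p q e t).2 i)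
      ((coneVelocity k α p q e t).2 i) = D.im ^ 2 := by
    simp_rw [hin]
    have : ∀ i, (k i : ℝ) * ((D.im / φ) ^ 2 * angle (p.2 i) (q.2 i) ^ 2) =
        (D.im / φ) ^ 2 * (k i * angle (p.2 i) (q.2 i) ^ 2) := fun i => by ring
    simp_rw [this]
    rw [← Finset.mul_sum, ← sphericalDist_sq]
    -- For `M = 0` the left side is `0` by the division convention; the chord is then real, so `D.im
    -- = 0` too.
    rcases hM0.eq_or_lt with h | h
    · have h0 : φ = 0 := by rw [hφdef, ← h, mul_zero]
      have hDim : D = (((q.1 - p.1) / ((1 - t) * p.1 + t * q.1) : ℝ) : ℂ) := by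
        rw [hD, hzdef, planarChord, h0]
        simp
      rw [hDim, Complex.ofReal_im]
      simp
    · rw [hφdef]
      field_simp
  have hv1 : (coneVelocity k α p q e t).1 = ‖z‖ * D.re := by
    simp only [coneVelocity]
    rw [← hφdef, ← hzdef, ← hD, hr]
  have hg1 : (coneGeodesic k α p q e t).1 = ‖z‖ := by
    simp only [coneGeodesic]
    rw [← hφdef, ← hzdef, hr]
  rw [preMetric, hv1, hg1, mul_pow, mul_right_comm (α ^ 2), hsum]
  have hz' : q.1 * Complex.exp (φ * Complex.I) - p.1 = D * z := by
    rw [hD, div_mul_cancel₀ _ hz0]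
  rw [hz', norm_mul, mul_pow, Complex.sq_norm D, Complex.normSq_apply]
  ring

include hα hp hq hpq he in
-- The lifted chord attains the planar lower bound taken at `m = M`. Any choice of directions will
-- do, so antipodal components are allowed as long as a direction exists.
theorem intrinsicDist_eq_coneDist (hk : ∀ i, 1 ≤ k i) :
    intrinsicDist (preSegreVeronese n) (preMetric n k α) p q = ENNReal.ofReal (coneDist k α p q) := by
  have h := isPiecewiseSmoothCurve_coneGeodesic hα hp hq hpq he
  apply le_antisymm
  · rw [← curveLength_of_const h fun t ht _ =>
      speed_coneGeodesic hα hp hq hpq he (Ioo_subset_Icc_self ht)]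
    exact iInf₂_le (f := fun (β : ℝ → PreSpace n)
      (_ : IsPiecewiseSmoothCurve (preSegreVeronese n) β ∧ β 0 = p ∧ β 1 = q) =>
        curveLength (preMetric n k α) β) _ ⟨h, coneGeodesic_zero hp, coneGeodesic_one hα hq hpq he hk⟩
  · refine le_iInf₂ fun β hβ => ?_
    obtain ⟨h1, rfl, rfl⟩ := hβ
    exact ofReal_norm_sub_le_lintegral_speed hk α h1 le_rfl one_pos le_rfl
      (sphericalDist_nonneg k _ _) le_rfl

end Hyp

/-- Gram–Schmidt: the component of `v` orthogonal to `u` has length `sin (angle u v)`. At angle `0`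
the vector is zero, hence the condition on the norm. -/
theorem exists_direction_of_ne_neg {V : Type*} [NormedAddCommGroup V] [InnerProductSpace ℝ V]
    {u v : V} (hu : ‖u‖ = 1) (hv : ‖v‖ = 1) (h : u ≠ -v) :
    inner ℝ u ((Real.sin (angle u v))⁻¹ • (v - (inner ℝ u v : ℝ) • u)) = 0 ∧
    (angle u v ≠ 0 → ‖(Real.sin (angle u v))⁻¹ • (v - (inner ℝ u v : ℝ) • u)‖ = 1) ∧
    v = Real.cos (angle u v) • u +
      Real.sin (angle u v) • (Real.sin (angle u v))⁻¹ • (v - (inner ℝ u v : ℝ) • u) := by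
  have hcos : Real.cos (angle u v) = inner ℝ u v := by simp [cos_angle, hu, hv]
  have h0 : angle u v = 0 → u = v := fun h0 => by
    rw [h0, Real.cos_zero] at hcos
    exact (inner_eq_one_iff_of_norm_eq_one hu hv).1 hcos.symm
  have hpi : angle u v ≠ Real.pi := fun h1 => by
    rw [h1, Real.cos_pi] at hcos
    exact h ((inner_eq_neg_one_iff_of_norm_eq_one hu hv).1 hcos.symm)
  have hsin : angle u v ≠ 0 → 0 < Real.sin (angle u v) := fun h =>
    Real.sin_pos_of_pos_of_lt_pi ((angle_nonneg _ _).lt_of_ne' h) ((angle_le_pi _ _).lt_of_ne hpi)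
  refine ⟨?_, fun h => ?_, ?_⟩
  · rw [real_inner_smul_right, inner_sub_right, real_inner_smul_right, real_inner_self_eq_norm_sq, hu]
    ring
  · have h1 : ‖v - (inner ℝ u v : ℝ) • u‖ ^ 2 = Real.sin (angle u v) ^ 2 := by
      rw [norm_sub_sq_real, real_inner_smul_right, norm_smul, hu, hv, Real.norm_eq_abs, mul_pow, sq_abs,
        real_inner_comm u v, Real.sin_sq, hcos]
      ring
    rw [sq_eq_sq₀ (norm_nonneg _) (hsin h).le] at h1
    rw [norm_smul, h1, norm_inv, Real.norm_of_nonneg (hsin h).le, inv_mul_cancel₀ (hsin h).ne']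
  · by_cases h : angle u v = 0
    · rw [h]
      simp [h0 h]
    · rw [smul_inv_smul₀ (hsin h).ne', hcos]
      abel

/-- The directions of the great circles if no two components are antipodal. -/
def uniqueDirection (p q : PreSpace n) (i : Fin d) : EuclideanSpace ℝ (Fin (n i)) :=
  (Real.sin (angle (p.2 i) (q.2 i)))⁻¹ • (q.2 i - (inner ℝ (p.2 i) (q.2 i) : ℝ) • p.2 i)

theorem isDirection_uniqueDirection {p q : PreSpace n} (hp : p ∈ preSegreVeronese n)
    (hq : q ∈ preSegreVeronese n) (h : ∀ i, p.2 i ≠ -q.2 i) :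
    IsDirection p q (uniqueDirection p q) :=
  ⟨fun i => (exists_direction_of_ne_neg (hp.2 i) (hq.2 i) (h i)).1,
    fun i => (exists_direction_of_ne_neg (hp.2 i) (hq.2 i) (h i)).2.1,
    fun i => (exists_direction_of_ne_neg (hp.2 i) (hq.2 i) (h i)).2.2⟩

/-- If two points can be joined by a curve, there are great circles between their components. -/
theorem exists_isDirection {p q : PreSpace n} {γ : ℝ → PreSpace n}
    (hγ : IsPiecewiseSmoothCurve (preSegreVeronese n) γ) (h0 : γ 0 = p) (h1 : γ 1 = q) :
    ∃ e, IsDirection p q e := by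
  have hp : p ∈ preSegreVeronese n := h0 ▸ hγ.2.1 0 ⟨le_rfl, zero_le_one⟩
  have hq : q ∈ preSegreVeronese n := h1 ▸ hγ.2.1 1 ⟨zero_le_one, le_rfl⟩
  have key : ∀ i, ∃ e, inner ℝ (p.2 i) e = 0 ∧ (angle (p.2 i) (q.2 i) ≠ 0 → ‖e‖ = 1) ∧
      q.2 i = Real.cos (angle (p.2 i) (q.2 i)) • p.2 i + Real.sin (angle (p.2 i) (q.2 i)) • e := by
    intro i
    by_cases h : p.2 i = -q.2 i
    · have hc : ContinuousOn (fun t => (inner ℝ (p.2 i) ((γ t).2 i) : ℝ)) (Icc 0 1) :=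
        continuousOn_const.inner ((continuous_apply i).comp_continuousOn
          (continuous_snd.comp_continuousOn hγ.1))
      have hpi : inner ℝ (p.2 i) (p.2 i) = (1 : ℝ) := by simp [hp.2 i]
      have hq' : q.2 i = -p.2 i := by rw [h, neg_neg]
      -- A curve from a point to its antipode crosses the equator, and the crossing point serves as
      -- direction. In the zero-dimensional sphere there is none, which is why a connecting curve is
      -- assumed.
      obtain ⟨t, ht, hte⟩ := intermediate_value_Icc' zero_le_one hc
        (show (0 : ℝ) ∈ Icc _ _ by
          simp only [h0, h1, hq', inner_neg_right, hpi]
          constructor <;> norm_num)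
      refine ⟨(γ t).2 i, hte, fun _ => (hγ.2.1 t ht).2 i, ?_⟩
      rw [hq', angle_self_neg_of_nonzero (by
        intro h; have := hp.2 i; rw [h, norm_zero] at this; exact zero_ne_one this)]
      simp
    · exact ⟨_, exists_direction_of_ne_neg (hp.2 i) (hq.2 i) h⟩
  choose e he using key
  exact ⟨e, fun i => (he i).1, fun i => (he i).2.1, fun i => (he i).2.2⟩

theorem coneVelocity_zero {k : Fin d → ℕ} (hk : ∀ i, 1 ≤ k i) {α : ℝ} (hα : 0 < α) {p q : PreSpace n}
    (hp : p ∈ preSegreVeronese n) (hq : q ∈ preSegreVeronese n) :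
    coneVelocity k α p q (uniqueDirection p q) 0 = preLog k α p q := by
  have hlog : Complex.log (p.1 : ℂ) = (Real.log p.1 : ℝ) := (Complex.ofReal_log hp.1.le).symm
  have hp1 := hp.1.ne'
  set φ := α * sphericalDist k p q with hφdef
  have hD : (q.1 * Complex.exp (φ * Complex.I) - p.1) / (p.1 : ℂ) =
      (((q.1 * Real.cos φ - p.1) / p.1 : ℝ) : ℂ) + ((q.1 * Real.sin φ / p.1 : ℝ) : ℂ) * Complex.I := by
    have : (p.1 : ℂ) ≠ 0 := by exact_mod_cast hp1
    rw [Complex.exp_mul_I]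
    push_cast
    field_simp
    ring
  refine Prod.ext ?_ (funext fun i => ?_)
  · simp only [coneVelocity, preLog, ← hφdef, planarChord_zero, hlog, hD, Complex.ofReal_re,
      Real.exp_log hp.1, Complex.add_re, Complex.re_ofReal_mul, Complex.I_re]
    field_simp
    ring
  · simp only [coneVelocity, preLog, ← hφdef, planarChord_zero, hlog, hD, Complex.ofReal_im,
      Complex.add_im, Complex.im_ofReal_mul, Complex.I_im, zero_div, zero_mul, Real.sin_zero,
      Real.cos_zero, neg_zero, zero_smul, zero_add, mul_one, uniqueDirection, smul_smul]
    -- At angle `0` the vector `vᵢ - ⟨uᵢ, vᵢ⟩ uᵢ` vanishes, so the different values of the two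
    -- coefficients there are irrelevant. A nonzero angle forces `M ≠ 0`.
    by_cases h0 : angle (p.2 i) (q.2 i) = 0
    · have h1 : p.2 i = q.2 i := by
        refine (inner_eq_one_iff_of_norm_eq_one (𝕜 := ℝ) (hp.2 i) (hq.2 i)).1 ?_
        have : Real.cos (angle (p.2 i) (q.2 i)) = inner ℝ (p.2 i) (q.2 i) := by
          simp [cos_angle, hp.2 i, hq.2 i]
        rw [← this, h0, Real.cos_zero]
      simp [h1, hq.2 i]
    · have hφ : φ ≠ 0 := fun hφ => h0 (angle_eq_zero_of_sphericalDist_eq_zero hk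
        ((mul_eq_zero.1 (hφdef ▸ hφ)).resolve_left hα.ne') i)
      rw [Real.sinc_of_ne_zero hφ, Real.sinc_of_ne_zero h0]
      congr 1
      field_simp

end Model

end SegreVeronese

namespace SegreVeronese

open MeasureTheory Set Filter Topology InnerProductGeometry

/-! ### Equality cases of the triangle inequalities: uniqueness of minimizers. -/

section Uniqueness

/-- The law of cosines; it makes planar distance strictly increasing in the angle on `[0, π]`. -/
theorem norm_sub_polar_sq (l r φ : ℝ) :
    ‖(l : ℂ) - r * Complex.exp (φ * Complex.I)‖ ^ 2 = l ^ 2 + r ^ 2 - 2 * l * r * Real.cos φ := by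
  have h : (l : ℂ) - r * Complex.exp (φ * Complex.I) =
      ((l - r * Real.cos φ : ℝ) : ℂ) + ((-(r * Real.sin φ) : ℝ) : ℂ) * Complex.I := by
    rw [Complex.exp_mul_I]; push_cast; ring
  rw [h, Complex.sq_norm, Complex.normSq_add_mul_I]
  nlinarith [Real.sin_sq_add_cos_sq φ]

theorem norm_sub_polar_lt {l r φ φ' : ℝ} (hl : 0 < l) (hr : 0 < r) (h0 : 0 ≤ φ) (h : φ < φ')
    (hpi : φ' ≤ Real.pi) :
    ‖(l : ℂ) - r * Complex.exp (φ * Complex.I)‖ < ‖(l : ℂ) - r * Complex.exp (φ' * Complex.I)‖ := by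
  refine lt_of_pow_lt_pow_left₀ 2 (norm_nonneg _) ?_
  rw [norm_sub_polar_sq, norm_sub_polar_sq]
  have := Real.cos_lt_cos_of_nonneg_of_le_pi h0 hpi h
  have hlr : 0 < 2 * l * r := by positivity
  nlinarith

/-- A bound for all planar distances up to an angle, attained at a smaller angle, is impossible. -/
theorem le_of_forall_norm_sub_polar_le {l r α a b C : ℝ} (hα : 0 < α) (hl : 0 < l) (hr : 0 < r)
    (h0 : 0 ≤ a) (ha : α * a < Real.pi)
    (h : ∀ m, 0 ≤ m → m ≤ b → ‖(l : ℂ) - r * Complex.exp ((α * m : ℝ) * Complex.I)‖ ≤ C)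
    (hC : C ≤ ‖(l : ℂ) - r * Complex.exp ((α * a : ℝ) * Complex.I)‖) : b ≤ a := by
  by_contra! hab
  have ha' : a < Real.pi / α := by rwa [lt_div_iff₀ hα, mul_comm]
  -- The angle is capped at `π`, beyond which planar distance is no longer monotone; `α a < π`
  -- leaves room above `a`.
  have hm : a < min b (Real.pi / α) := lt_min hab ha'
  have h1 := h _ (h0.trans hm.le) (min_le_left _ _)
  have h2 : α * min b (Real.pi / α) ≤ Real.pi := by
    rw [← le_div_iff₀' hα]; exact min_le_right _ _
  exact absurd (h1.trans hC)
    (not_le.2 (norm_sub_polar_lt hl hr (by positivity) (mul_lt_mul_of_pos_left hm hα) h2))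

theorem norm_polar_sub_polar (r m φ φ' : ℝ) :
    ‖(r : ℂ) * Complex.exp (φ * Complex.I) - m * Complex.exp (φ' * Complex.I)‖ =
      ‖(r : ℂ) - m * Complex.exp ((φ' - φ : ℝ) * Complex.I)‖ := by
  have : (r : ℂ) * Complex.exp (φ * Complex.I) - m * Complex.exp (φ' * Complex.I) =
      (r - m * Complex.exp ((φ' - φ : ℝ) * Complex.I)) * Complex.exp (φ * Complex.I) := by
    rw [sub_mul, mul_assoc, ← Complex.exp_add]
    congr 3
    push_cast; ring
  rw [this, norm_mul, Complex.norm_exp_ofReal_mul_I, mul_one]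

/-- A unit vector for which the triangle inequality of angles is an equality lies on a great circle. -/
theorem eq_rotation_of_angle {V : Type*} [NormedAddCommGroup V] [InnerProductSpace ℝ V]
    {u v x : V} (hu : ‖u‖ = 1) (hv : ‖v‖ = 1) (hx : ‖x‖ = 1) (h : u ≠ -v) {β : ℝ}
    (h1 : angle u x = β) (h2 : angle x v = angle u v - β) :
    x = Real.cos β • u +
      Real.sin β • (Real.sin (angle u v))⁻¹ • (v - (inner ℝ u v : ℝ) • u) := by
  have hc : ∀ {a b : V}, ‖a‖ = 1 → ‖b‖ = 1 → inner ℝ a b = Real.cos (angle a b) := by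
    intro a b ha hb
    simp [cos_angle, ha, hb]
  obtain ⟨e1, e2, e3⟩ := exists_direction_of_ne_neg hu hv h
  by_cases h0 : angle u v = 0
  · have hβ : β = 0 := by
      have := angle_nonneg u x
      have := angle_nonneg x v
      linarith
    have : u = x := (inner_eq_one_iff_of_norm_eq_one (𝕜 := ℝ) hu hx).1 (by rw [hc hu hx, h1, hβ, Real.cos_zero])
    simp [hβ, this]
  · have hs : Real.sin (angle u v) ≠ 0 := by
      intro hs
      have := e2 h0
      rw [hs] at this
      simp at this
    -- Both sides are unit vectors, so it suffices that their inner product is `1`; the addition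
    -- formula for `cos (θ - β)` reduces it to `cos² β + sin² β`.
    refine (inner_eq_one_iff_of_norm_eq_one (𝕜 := ℝ) hx
      (norm_rotation hu (e2 h0) e1 (Real.cos_sq_add_sin_sq β))).1 ?_
    rw [inner_add_right, real_inner_smul_right, real_inner_smul_right, real_inner_smul_right,
      inner_sub_right, real_inner_smul_right, hc hx hv, real_inner_comm, hc hu hx, hc hu hv, h1, h2,
      Real.cos_sub]
    field_simp
    linear_combination Real.sin (angle u v) * Real.sin_sq_add_cos_sq β

variable {d : ℕ} {n : Fin d → ℕ}

/-- The angles between the components, as a vector of the Euclidean space. -/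
def angleVector (k : Fin d → ℕ) (p q : PreSpace n) : EuclideanSpace ℝ (Fin d) :=
  WithLp.toLp 2 fun i => √(k i) * angle (p.2 i) (q.2 i)

theorem norm_angleVector (k : Fin d → ℕ) (p q : PreSpace n) :
    ‖angleVector k p q‖ = sphericalDist k p q := by
  rw [EuclideanSpace.norm_eq, sphericalDist]
  congr 1
  refine Finset.sum_congr rfl fun i _ => ?_
  rw [Real.norm_eq_abs, sq_abs]
  simp [angleVector, mul_pow]

theorem angleVector_le_add (k : Fin d → ℕ) (p x q : PreSpace n) (i : Fin d) :
    angleVector k p q i ≤ angleVector k p x i + angleVector k x q i := by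
  simp only [angleVector, ← mul_add]
  exact mul_le_mul_of_nonneg_left (angle_le_angle_add_angle _ _ _) (Real.sqrt_nonneg _)

theorem angleVector_nonneg (k : Fin d → ℕ) (p q : PreSpace n) (i : Fin d) :
    0 ≤ angleVector k p q i := mul_nonneg (Real.sqrt_nonneg _) (angle_nonneg _ _)

theorem norm_angleVector_le_norm_add (k : Fin d → ℕ) (p x q : PreSpace n) :
    ‖angleVector k p q‖ ≤ ‖angleVector k p x + angleVector k x q‖ := by
  rw [EuclideanSpace.norm_eq, EuclideanSpace.norm_eq]
  refine Real.sqrt_le_sqrt (Finset.sum_le_sum fun i _ => ?_)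
  rw [Real.norm_eq_abs, Real.norm_eq_abs, sq_abs, sq_abs]
  exact pow_le_pow_left₀ (angleVector_nonneg k p q i) (angleVector_le_add k p x q i) 2

theorem sphericalDist_triangle (k : Fin d → ℕ) (p x q : PreSpace n) :
    sphericalDist k p q ≤ sphericalDist k p x + sphericalDist k x q := by
  simp only [← norm_angleVector]
  exact (norm_angleVector_le_norm_add k p x q).trans (norm_add_le _ _)

/-- If the triangle inequality for the weighted spherical distance is an equality, the angles are
proportional. -/
theorem angle_of_sphericalDist_add_eq {k : Fin d → ℕ} (hk : ∀ i, 1 ≤ k i) {p x q : PreSpace n}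
    (h : sphericalDist k p x + sphericalDist k x q = sphericalDist k p q) (i : Fin d) :
    angle (p.2 i) (x.2 i) = sphericalDist k p x / sphericalDist k p q * angle (p.2 i) (q.2 i) ∧
      angle (x.2 i) (q.2 i) = angle (p.2 i) (q.2 i) -
        sphericalDist k p x / sphericalDist k p q * angle (p.2 i) (q.2 i) := by
  have hnorm : ‖angleVector k p x + angleVector k x q‖ = ‖angleVector k p q‖ := by
    refine le_antisymm ((norm_add_le _ _).trans ?_) (norm_angleVector_le_norm_add k p x q)
    rw [norm_angleVector, norm_angleVector, norm_angleVector, h]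
  have hsq : ∑ i, ((angleVector k p x i + angleVector k x q i) ^ 2 - angleVector k p q i ^ 2) = 0 := by
    rw [Finset.sum_sub_distrib, sub_eq_zero]
    have := congrArg (· ^ 2) hnorm
    simpa only [EuclideanSpace.norm_sq_eq, PiLp.add_apply, Real.norm_eq_abs, sq_abs] using this
  -- The norms agree and one vector dominates the other in every nonnegative coordinate, so the
  -- coordinates agree.
  have hadd : angleVector k p x + angleVector k x q = angleVector k p q := by
    rw [Finset.sum_eq_zero_iff_of_nonneg fun i _ => sub_nonneg.2
      (pow_le_pow_left₀ (angleVector_nonneg k p q i) (angleVector_le_add k p x q i) 2)] at hsq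
    ext j
    have h1 := sub_eq_zero.1 (hsq j (Finset.mem_univ j))
    rwa [sq_eq_sq₀ (add_nonneg (angleVector_nonneg _ _ _ _) (angleVector_nonneg _ _ _ _))
      (angleVector_nonneg _ _ _ _)] at h1
  set M := sphericalDist k p q with hM
  set a := sphericalDist k p x with ha
  have haM : a / M * M = a := by
    rcases eq_or_ne M 0 with h0 | h0
    · have h1 := sphericalDist_nonneg k p x
      have h2 := sphericalDist_nonneg k x q
      have : a = 0 := by linarith
      simp [this]
    · exact div_mul_cancel₀ _ h0
  -- Strict convexity of the Euclidean norm: equality in the triangle inequality puts the vector on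
  -- the segment, so the angles are proportional.
  have hline : angleVector k p x = AffineMap.lineMap 0 (angleVector k p q) (a / M) := by
    refine eq_lineMap_of_dist_eq_mul_of_dist_eq_mul ?_ ?_
    · rw [dist_zero_left, dist_zero_left, norm_angleVector, norm_angleVector, ← hM, haM]
    · rw [dist_zero_left, ← hadd, dist_self_add_right, hadd, norm_angleVector, norm_angleVector, sub_mul,
        ← hM, haM]
      linarith
  have hki : √(k i : ℝ) ≠ 0 := by
    have : 0 < k i := hk i
    positivity
  have h1 : √(k i : ℝ) * angle (p.2 i) (x.2 i) = a / M * (√(k i) * angle (p.2 i) (q.2 i)) := by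
    have := congrArg (fun v : EuclideanSpace ℝ (Fin d) => v i) hline
    simpa [AffineMap.lineMap_apply, angleVector] using this
  have h2 : √(k i : ℝ) * angle (p.2 i) (x.2 i) + √(k i : ℝ) * angle (x.2 i) (q.2 i) =
      √(k i) * angle (p.2 i) (q.2 i) := by
    have := congrArg (fun v : EuclideanSpace ℝ (Fin d) => v i) hadd
    simpa [angleVector] using this
  have h3 : angle (p.2 i) (x.2 i) = a / M * angle (p.2 i) (q.2 i) :=
    mul_left_cancel₀ hki (by rw [h1]; ring)
  have h4 : angle (p.2 i) (x.2 i) + angle (x.2 i) (q.2 i) = angle (p.2 i) (q.2 i) :=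
    mul_left_cancel₀ hki (by rw [mul_add, h2])
  exact ⟨h3, by linarith⟩

/-- A point between `p` and `q` lies on the geodesic from `p` to `q`. -/
theorem eq_coneGeodesic_of_dist_le {k : Fin d → ℕ} (hk : ∀ i, 1 ≤ k i) {α : ℝ} (hα : 0 < α)
    {p q x : PreSpace n} (hp : p ∈ preSegreVeronese n) (hq : q ∈ preSegreVeronese n)
    (hx : x ∈ preSegreVeronese n) (hpq : IsCompatible k α p q) (hne : ∀ i, p.2 i ≠ -q.2 i) {t : ℝ}
    (h1 : ∀ m, 0 ≤ m → m ≤ sphericalDist k p x →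
      ‖(p.1 : ℂ) - x.1 * Complex.exp ((α * m : ℝ) * Complex.I)‖ ≤ t * coneDist k α p q)
    (h2 : ∀ m, 0 ≤ m → m ≤ sphericalDist k x q →
      ‖(x.1 : ℂ) - q.1 * Complex.exp ((α * m : ℝ) * Complex.I)‖ ≤ (1 - t) * coneDist k α p q) :
    x = coneGeodesic k α p q (uniqueDirection p q) t := by
  have hφ := mul_sphericalDist_lt_pi hα hpq
  have htri := sphericalDist_triangle k p x q
  have ha0 := sphericalDist_nonneg k p x
  have hM0 := sphericalDist_nonneg k p q
  set M := sphericalDist k p q with hM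
  set a := sphericalDist k p x with ha
  set b := sphericalDist k x q with hb
  set L := coneDist k α p q with hL
  -- A priori `a` may exceed `M`, so the point `x` is first placed in the plane at the angle `α a'`,
  -- between those of `p` and `q`. The planar triangle inequality then turns both bounds into
  -- equalities.
  set a' := min a M with ha'
  have ha'0 : 0 ≤ a' := le_min ha0 hM0
  have ha'M : a' ≤ M := min_le_right _ _
  have hb' : M - a' ≤ b := by
    rw [ha']
    rcases min_cases a M with h | h
    · rw [h.1]; linarith
    · rw [h.1, sub_self]; exact sphericalDist_nonneg k x q
  have e1 := h1 a' ha'0 (min_le_left _ _)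
  have e2 := h2 (M - a') (by linarith) hb'
  rw [mul_sub, ← norm_polar_sub_polar] at e2
  have e3 : L ≤ _ := norm_sub_le_norm_sub_add_norm_sub (p.1 : ℂ)
    (x.1 * Complex.exp ((α * a' : ℝ) * Complex.I)) (q.1 * Complex.exp ((α * M : ℝ) * Complex.I))
  have f1 : ‖(p.1 : ℂ) - x.1 * Complex.exp ((α * a' : ℝ) * Complex.I)‖ = t * L := by linarith
  have f2 : ‖(x.1 : ℂ) * Complex.exp ((α * a' : ℝ) * Complex.I) -
      q.1 * Complex.exp ((α * M : ℝ) * Complex.I)‖ = (1 - t) * L := by linarith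
  -- Were `a` larger than `a'`, the bound `h1` at a larger angle would contradict the equality just
  -- found. The same holds for `b`, so `a + b = M`.
  have haa' : a ≤ a' := by
    refine le_of_forall_norm_sub_polar_le hα hp.1 hx.1 ha'0 ?_ h1 f1.ge
    exact (mul_le_mul_of_nonneg_left ha'M hα.le).trans_lt hφ
  have hba' : b ≤ M - a' := by
    refine le_of_forall_norm_sub_polar_le hα hx.1 hq.1 (by linarith) ?_ h2 ?_
    · exact (mul_le_mul_of_nonneg_left (by linarith) hα.le).trans_lt hφ
    · rw [mul_sub, ← norm_polar_sub_polar, f2]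
  have haeq : a' = a := le_antisymm (min_le_left _ _) haa'
  have hab : a + b = M := by linarith
  have hz : planarChord p.1 q.1 (α * M) t = x.1 * Complex.exp ((α * a : ℝ) * Complex.I) := by
    have hl : (x.1 : ℂ) * Complex.exp ((α * a' : ℝ) * Complex.I) =
        AffineMap.lineMap (p.1 : ℂ) (q.1 * Complex.exp ((α * M : ℝ) * Complex.I)) t := by
      refine eq_lineMap_of_dist_eq_mul_of_dist_eq_mul ?_ ?_
      · rw [dist_eq_norm, dist_eq_norm, f1]; rfl
      · rw [dist_eq_norm, dist_eq_norm, f2]; rfl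
    rw [haeq] at hl
    rw [hl, AffineMap.lineMap_apply, planarChord]
    simp only [vsub_eq_sub, vadd_eq_add, Complex.real_smul]
    ring
  obtain ⟨g1, g2⟩ := log_polar hx.1 (mul_nonneg hα.le ha0)
    ((mul_le_mul_of_nonneg_left (by linarith) hα.le).trans_lt hφ)
  refine Prod.ext ?_ (funext fun i => ?_)
  · simp only [coneGeodesic, ← hM, hz, g1]
    exact (Real.exp_log hx.1).symm
  · simp only [coneGeodesic, ← hM, hz, g2, mul_div_mul_left _ _ hα.ne']
    obtain ⟨j1, j2⟩ := angle_of_sphericalDist_add_eq hk hab i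
    exact eq_rotation_of_angle (hp.2 i) (hq.2 i) (hx.2 i) (hne i) j1 j2

end Uniqueness

end SegreVeronese

namespace SegreVeronese

open MeasureTheory Set Filter Topology

/-! ### The tensor map: local isometry and local sections. -/

section Tensors

variable {d : ℕ} {n k : Fin d → ℕ}

/-- The tensor product of a family of vectors, one for each of the `k₁ + ⋯ + k_d` slots. -/
def pureTensor (x : (s : Σ i, Fin (k i)) → EuclideanSpace ℝ (Fin (n s.1))) : TensorSpace n k :=
  WithLp.toLp 2 fun J => ∏ s, x s (J s.1 s.2)

theorem inner_pureTensor (x y : (s : Σ i, Fin (k i)) → EuclideanSpace ℝ (Fin (n s.1))) :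
    inner ℝ (pureTensor x) (pureTensor y) = ∏ s, inner ℝ (x s) (y s) := by
  simp only [PiLp.inner_apply, pureTensor, RCLike.inner_apply, conj_trivial]
  rw [Finset.prod_univ_sum, Fintype.piFinset_univ,
    ← (Equiv.piCurry fun (i : Fin d) (_ : Fin (k i)) => Fin (n i)).sum_comp]
  refine Finset.sum_congr rfl fun J _ => ?_
  rw [← Finset.prod_mul_distrib]
  rfl

theorem prod_update_apply [DecidableEq (Σ i, Fin (k i))]
    (x : (s : Σ i, Fin (k i)) → EuclideanSpace ℝ (Fin (n s.1))) (s : Σ i, Fin (k i))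
    (z : EuclideanSpace ℝ (Fin (n s.1))) (J : (i : Fin d) → Fin (k i) → Fin (n i)) :
    ∏ r, Function.update x s z r (J r.1 r.2) =
      z (J s.1 s.2) * ∏ r ∈ Finset.univ.erase s, x r (J r.1 r.2) := by
  rw [← Finset.mul_prod_erase _ _ (Finset.mem_univ s), Function.update_self]
  congr 1
  exact Finset.prod_congr rfl fun r hr => by rw [Function.update_of_ne (Finset.ne_of_mem_erase hr)]

/-- `pureTensor` as a continuous multilinear map. -/
def pureTensorMap (n k : Fin d → ℕ) :
    ContinuousMultilinearMap ℝ (fun s : Σ i, Fin (k i) => EuclideanSpace ℝ (Fin (n s.1)))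
      (TensorSpace n k) where
  toFun := pureTensor
  map_update_add' x s y z := by
    ext J
    simp only [pureTensor, PiLp.add_apply, prod_update_apply, add_mul]
  map_update_smul' x s c y := by
    ext J
    simp only [pureTensor, PiLp.smul_apply, prod_update_apply, smul_eq_mul, mul_assoc]
  cont := by
    unfold pureTensor
    fun_prop

theorem tensorMap_eq (p : PreSpace n) :
    tensorMap n k p = p.1 • pureTensorMap n k fun s => p.2 s.1 := by
  ext J
  change _ = p.1 * ∏ s : Σ i, Fin (k i), p.2 s.1 (J s.1 s.2)
  rw [Fintype.prod_sigma]
  rfl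

theorem inner_pureTensorMap (x y : (s : Σ i, Fin (k i)) → EuclideanSpace ℝ (Fin (n s.1))) :
    inner ℝ (pureTensorMap n k x) (pureTensorMap n k y) = ∏ s, inner ℝ (x s) (y s) :=
  inner_pureTensor x y

/-- The linear map that places the components of a point in the slots. -/
def slots (n k : Fin d → ℕ) :
    PreSpace n →L[ℝ] (s : Σ i, Fin (k i)) → EuclideanSpace ℝ (Fin (n s.1)) :=
  ContinuousLinearMap.pi fun s =>
    (ContinuousLinearMap.proj s.1).comp (ContinuousLinearMap.snd ℝ ℝ _)

theorem hasFDerivAt_tensorMap (p : PreSpace n) :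
    HasFDerivAt (tensorMap n k) (fderiv ℝ (tensorMap n k) p) p ∧
    ∀ w : PreSpace n, fderiv ℝ (tensorMap n k) p w =
      w.1 • pureTensorMap n k (slots n k p) + p.1 • ∑ s, pureTensorMap n k
        (Function.update (slots n k p) s (w.2 s.1)) := by
  have h1 := (((pureTensorMap n k).hasFDerivAt (slots n k p)).comp p (slots n k).hasFDerivAt)
  have h2 := (ContinuousLinearMap.fst ℝ ℝ ((i : Fin d) → EuclideanSpace ℝ (Fin (n i)))).hasFDerivAt
    (x := p)
  have h3 := h2.smul h1
  have h4 : HasFDerivAt (tensorMap n k) _ p := h3.congr_of_eventuallyEq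
    (Eventually.of_forall fun q => tensorMap_eq q)
  refine ⟨h4.differentiableAt.hasFDerivAt, fun w => ?_⟩
  rw [h4.fderiv]
  simp only [add_apply, smul_apply,
    ContinuousLinearMap.smulRight_apply, ContinuousLinearMap.comp_apply,
    ContinuousMultilinearMap.linearDeriv_apply]
  rw [add_comm]
  rfl

theorem contDiff_tensorMap : ContDiff ℝ ∞ (tensorMap n k) := by
  have h : tensorMap n k = fun p => p.1 • pureTensorMap n k (slots n k p) :=
    funext fun p => tensorMap_eq p
  rw [h]
  exact contDiff_fst.smul ((pureTensorMap n k).contDiff.comp (slots n k).contDiff)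

theorem norm_pureTensorMap_slots {p : PreSpace n} (hp : p ∈ preSegreVeronese n) :
    ‖pureTensorMap n k (slots n k p)‖ = 1 := by
  have h : inner ℝ (pureTensorMap n k (slots n k p)) (pureTensorMap n k (slots n k p)) = (1 : ℝ) := by
    rw [inner_pureTensorMap]
    refine Finset.prod_eq_one fun s _ => ?_
    rw [real_inner_self_eq_norm_sq, show slots n k p s = p.2 s.1 from rfl, hp.2, one_pow]
  rw [real_inner_self_eq_norm_sq] at h
  nlinarith [norm_nonneg (pureTensorMap n k (slots n k p))]

theorem norm_tensorMap {p : PreSpace n} (hp : p ∈ preSegreVeronese n) : ‖tensorMap n k p‖ = p.1 := by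
  rw [tensorMap_eq, norm_smul, Real.norm_of_nonneg hp.1.le]
  have := norm_pureTensorMap_slots (k := k) hp
  change p.1 * ‖pureTensorMap n k (slots n k p)‖ = p.1
  rw [this, mul_one]

/-- The map `⊗` is a local isometry. -/
theorem warpedMetric_fderiv_tensorMap (α : ℝ) {p w : PreSpace n} (hp : p ∈ preSegreVeronese n)
    (hw : ∀ i, inner ℝ (p.2 i) (w.2 i) = 0) :
    warpedMetric α (tensorMap n k p) (fderiv ℝ (tensorMap n k) p w)
      (fderiv ℝ (tensorMap n k) p w) = preMetric n k α p w w := by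
  set U := pureTensorMap n k (slots n k p) with hU
  set W := ∑ s, pureTensorMap n k (Function.update (slots n k p) s (w.2 s.1)) with hW
  have hU1 : ‖U‖ = 1 := norm_pureTensorMap_slots hp
  have hunit : ∀ s, inner ℝ (slots n k p s) (slots n k p s) = (1 : ℝ) := fun s => by
    rw [real_inner_self_eq_norm_sq, show slots n k p s = p.2 s.1 from rfl, hp.2, one_pow]
  have hUW : inner ℝ U W = (0 : ℝ) := by
    rw [hW, inner_sum]
    refine Finset.sum_eq_zero fun s _ => ?_
    rw [hU, inner_pureTensorMap]
    refine Finset.prod_eq_zero (Finset.mem_univ s) ?_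
    rw [Function.update_self]
    exact hw s.1
  have hWW : inner ℝ W W = ∑ i, (k i : ℝ) * inner ℝ (w.2 i) (w.2 i) := by
    -- Tensors with a tangent vector in different slots are orthogonal, since `p.2 i ⊥ w.2 i`. Each
    -- factor has `k i` slots, which accounts for the weight `k i` in the metric.
    have hst : ∀ s r : Σ i, Fin (k i), inner ℝ
        (pureTensorMap n k (Function.update (slots n k p) s (w.2 s.1)))
        (pureTensorMap n k (Function.update (slots n k p) r (w.2 r.1))) =
          if s = r then inner ℝ (w.2 s.1) (w.2 s.1) else (0 : ℝ) := by
      intro s r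
      rw [inner_pureTensorMap]
      split_ifs with h
      · subst h
        rw [Finset.prod_eq_single s]
        · rw [Function.update_self]
        · intro r _ hr
          rw [Function.update_of_ne hr, hunit]
        · simp
      · refine Finset.prod_eq_zero (Finset.mem_univ s) ?_
        rw [Function.update_self, Function.update_of_ne h, real_inner_comm]
        exact hw s.1
    rw [hW, sum_inner]
    simp_rw [inner_sum, hst]
    simp only [Finset.sum_ite_eq, Finset.mem_univ, if_true]
    rw [Fintype.sum_sigma]
    simp
  have hD : fderiv ℝ (tensorMap n k) p w = w.1 • U + p.1 • W := (hasFDerivAt_tensorMap p).2 w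
  have hx : ‖tensorMap n k p‖⁻¹ • tensorMap n k p = U := by
    rw [norm_tensorMap hp, tensorMap_eq, inv_smul_smul₀ hp.1.ne']
    rfl
  have hr : inner ℝ U (w.1 • U + p.1 • W) = w.1 := by
    rw [inner_add_right, real_inner_smul_right, real_inner_smul_right, hUW,
      real_inner_self_eq_norm_sq, hU1]
    ring
  simp only [warpedMetric, hx, hD, hr, add_sub_cancel_left, preMetric]
  rw [real_inner_smul_left, real_inner_smul_right, hWW]
  ring

theorem continuousAt_preMetric (α : ℝ) (p v : PreSpace n) :
    ContinuousAt (fun z : PreSpace n × PreSpace n => preMetric n k α z.1 z.2 z.2) (p, v) := by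
  unfold preMetric
  fun_prop

theorem continuousAt_warpedMetric {V : Type*} [NormedAddCommGroup V] [InnerProductSpace ℝ V] (α : ℝ)
    {x : V} (hx : x ≠ 0) (v : V) :
    ContinuousAt (fun z : V × V => warpedMetric α z.1 z.2 z.2) (x, v) := by
  have h : ContinuousAt (fun z : V × V => ‖z.1‖⁻¹) (x, v) :=
    continuousAt_fst.norm.inv₀ (by simpa using hx)
  unfold warpedMetric
  fun_prop

/-- The contraction of a tensor with the components of `p` in all slots but the first one of the
`i`-th factor. -/
def contraction (hk : ∀ i, 1 ≤ k i) (p : PreSpace n) (i : Fin d) (T : TensorSpace n k) :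
    EuclideanSpace ℝ (Fin (n i)) :=
  WithLp.toLp 2 fun a => inner ℝ T
    (pureTensorMap n k (Function.update (slots n k p) ⟨i, ⟨0, hk i⟩⟩ (EuclideanSpace.single a 1)))

/-- The scalar is the radius times the inner products in the remaining slots. Restoring the missing
one gives the full inner product, which controls the sign of `C`. -/
theorem contraction_tensorMap (hk : ∀ i, 1 ≤ k i) (p q : PreSpace n) (i : Fin d) :
    ∃ C : ℝ, contraction hk p i (tensorMap n k q) = C • q.2 i ∧
      C * inner ℝ (q.2 i) (p.2 i) = inner ℝ (tensorMap n k q) (pureTensorMap n k (slots n k p)) ∧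
      (0 < q.1 → (∀ j, 0 < inner ℝ (q.2 j) (p.2 j)) → 0 < C) := by
  set s : Σ i, Fin (k i) := ⟨i, ⟨0, hk i⟩⟩ with hs
  refine ⟨q.1 * ∏ r ∈ Finset.univ.erase s, inner ℝ (q.2 r.1) (p.2 r.1), ?_, ?_, fun h0 h => ?_⟩
  · ext a
    simp only [contraction, tensorMap_eq, PiLp.smul_apply]
    rw [real_inner_smul_left, inner_pureTensorMap, ← Finset.mul_prod_erase _ _ (Finset.mem_univ s),
      Function.update_self, Finset.prod_congr rfl fun r hr => by
        rw [Function.update_of_ne (Finset.ne_of_mem_erase hr)]]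
    rw [show inner ℝ (q.2 s.1) (EuclideanSpace.single a (1 : ℝ)) = q.2 i a by
      rw [EuclideanSpace.inner_single_right]; simp; rfl]
    simp only [smul_eq_mul, slots, ContinuousLinearMap.coe_pi', ContinuousLinearMap.comp_apply,
      ContinuousLinearMap.proj_apply, ContinuousLinearMap.coe_snd']
    ring
  · rw [tensorMap_eq, real_inner_smul_left, inner_pureTensorMap,
      ← Finset.mul_prod_erase _ _ (Finset.mem_univ s), mul_right_comm, mul_assoc]
    rfl
  · exact mul_pos h0 (Finset.prod_pos fun r _ => h r.1)

/-- A local section of `⊗` near `⊗ p`. -/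
def localSection (hk : ∀ i, 1 ≤ k i) (p : PreSpace n) (T : TensorSpace n k) : PreSpace n :=
  (‖T‖, fun i => ‖contraction hk p i T‖⁻¹ • contraction hk p i T)

/-- If every component of `q` lies in the open hemisphere around that of `p`, then `C > 0` and
normalising loses no sign. -/
theorem localSection_tensorMap_of_pos (hk : ∀ i, 1 ≤ k i) {p q : PreSpace n}
    (hq : q ∈ preSegreVeronese n) (h : ∀ i, 0 < inner ℝ (q.2 i) (p.2 i)) :
    localSection hk p (tensorMap n k q) = q := by
  refine Prod.ext (norm_tensorMap hq) (funext fun i => ?_)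
  obtain ⟨C, hC, -, hC0⟩ := contraction_tensorMap hk p q i
  have := hC0 hq.1 h
  simp only [localSection, hC, norm_smul, hq.2 i, mul_one, Real.norm_of_nonneg this.le]
  rw [inv_smul_smul₀ this.ne']

theorem contraction_ne_zero (hk : ∀ i, 1 ≤ k i) {p : PreSpace n} {T : TensorSpace n k}
    (hT : T ∈ segreVeronese n k) (h : 0 < inner ℝ T (pureTensorMap n k (slots n k p))) (i : Fin d) :
    contraction hk p i T ≠ 0 := by
  obtain ⟨q, hq, rfl⟩ := hT
  obtain ⟨C, hC, hC', -⟩ := contraction_tensorMap hk p q i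
  intro h0
  rw [← hC'] at h
  rw [hC, smul_eq_zero] at h0
  rcases h0 with h0 | h0
  · simp [h0] at h
  · simp [h0] at h

theorem localSection_mem (hk : ∀ i, 1 ≤ k i) {p : PreSpace n} {T : TensorSpace n k}
    (hT : T ∈ segreVeronese n k) (h : 0 < inner ℝ T (pureTensorMap n k (slots n k p))) :
    localSection hk p T ∈ preSegreVeronese n := by
  refine ⟨norm_pos_iff.2 fun h0 => ?_, fun i => ?_⟩
  · simp [h0] at h
  · exact norm_smul_inv_norm (𝕜 := ℝ) (contraction_ne_zero hk hT h i)

/-- The section may flip signs of components, so it recovers the tensor up to a total sign `E` with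
`E ^ 2 = 1`. The flipped components all pair positively with those of `p`, and so does `T` as a
whole; hence `E = 1`. -/
theorem tensorMap_localSection (hk : ∀ i, 1 ≤ k i) {p : PreSpace n} {T : TensorSpace n k}
    (hT : T ∈ segreVeronese n k) (h : 0 < inner ℝ T (pureTensorMap n k (slots n k p))) :
    tensorMap n k (localSection hk p T) = T := by
  have hmem := localSection_mem hk hT h
  have hne := contraction_ne_zero hk hT h
  obtain ⟨q, hq, rfl⟩ := hT
  choose C hCC using contraction_tensorMap hk p q
  have hC := fun i => (hCC i).1
  have hC' := fun i => (hCC i).2.1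
  have hC0 : ∀ i, C i ≠ 0 := fun i h0 => hne i (by rw [hC, h0, zero_smul])
  have hsec : ∀ i, (localSection hk p (tensorMap n k q)).2 i = (|C i|⁻¹ * C i) • q.2 i := by
    intro i
    simp only [localSection, hC, norm_smul, hq.2 i, mul_one, Real.norm_eq_abs, smul_smul]
  set E : ℝ := ∏ s : Σ i, Fin (k i), (|C s.1|⁻¹ * C s.1) with hE
  have hEsq : E ^ 2 = 1 := by
    rw [hE, ← Finset.prod_pow]
    refine Finset.prod_eq_one fun s _ => ?_
    rw [mul_pow, inv_pow, sq_abs, inv_mul_cancel₀ (pow_ne_zero 2 (hC0 s.1))]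
  have hT : tensorMap n k (localSection hk p (tensorMap n k q)) = E • tensorMap n k q := by
    rw [tensorMap_eq (localSection hk p (tensorMap n k q))]
    simp_rw [hsec]
    rw [(pureTensorMap n k).map_smul_univ (fun s => |C s.1|⁻¹ * C s.1) (fun s => q.2 s.1), ← hE]
    rw [show (localSection hk p (tensorMap n k q)).1 = q.1 from norm_tensorMap hq, smul_comm,
      ← tensorMap_eq]
  have hpos : 0 < inner ℝ (tensorMap n k (localSection hk p (tensorMap n k q)))
      (pureTensorMap n k (slots n k p)) := by
    rw [tensorMap_eq, real_inner_smul_left, inner_pureTensorMap]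
    refine mul_pos hmem.1 (Finset.prod_pos fun s _ => ?_)
    rw [hsec, real_inner_smul_left, mul_assoc]
    exact mul_pos (inv_pos.2 (abs_pos.2 (hC0 _))) ((hC' s.1).symm ▸ h)
  rw [hT, real_inner_smul_left] at hpos
  have hE0 : 0 < E := pos_of_mul_pos_left hpos h.le
  have hE1 : E = 1 := by nlinarith
  rw [hT, hE1, one_smul]

theorem contDiff_contraction (hk : ∀ i, 1 ≤ k i) (p : PreSpace n) (i : Fin d) :
    ContDiff ℝ ∞ (contraction (k := k) hk p i) := by
  refine contDiff_euclidean.2 fun a => ?_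
  exact contDiff_id.inner ℝ contDiff_const

theorem contDiffAt_localSection (hk : ∀ i, 1 ≤ k i) {p : PreSpace n} {T : TensorSpace n k}
    (hT : T ∈ segreVeronese n k) (h : 0 < inner ℝ T (pureTensorMap n k (slots n k p))) :
    ContDiffAt ℝ ∞ (localSection hk p) T := by
  have hT0 : T ≠ 0 := fun h0 => by simp [h0] at h
  refine (contDiffAt_norm ℝ hT0).prodMk (contDiffAt_pi.2 fun i => ?_)
  have hc := (contDiff_contraction hk p i).contDiffAt (x := T)
  have hne := contraction_ne_zero hk hT h i
  exact ((hc.norm ℝ hne).inv (norm_ne_zero_iff.2 hne)).smul hc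

end Tensors

/-! ### Lifting curves through the tensor map. -/

section Lifting

variable {d : ℕ} {n k : Fin d → ℕ}

theorem ne_zero_of_mem_segreVeronese {T : TensorSpace n k} (hT : T ∈ segreVeronese n k) : T ≠ 0 := by
  obtain ⟨q, hq, rfl⟩ := hT
  rw [← norm_pos_iff, norm_tensorMap hq]
  exact hq.1

theorem inner_pureTensorMap_slots_pos {p : PreSpace n} (hp : p ∈ preSegreVeronese n)
    {T : TensorSpace n k} (h : 0 < inner ℝ T (tensorMap n k p)) :
    0 < inner ℝ T (pureTensorMap n k (slots n k p)) := by
  rw [tensorMap_eq, real_inner_smul_right] at h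
  exact pos_of_mul_pos_right h hp.1.le

/-- Nearby values of a curve without zeros have positive inner products. -/
theorem exists_inner_pos {V : Type*} [NormedAddCommGroup V] [InnerProductSpace ℝ V] {β : ℝ → V}
    (hβ : ContinuousOn β (Icc 0 1)) (h0 : ∀ t ∈ Icc (0 : ℝ) 1, β t ≠ 0) :
    ∃ δ > 0, ∀ s ∈ Icc (0 : ℝ) 1, ∀ t ∈ Icc (0 : ℝ) 1, |s - t| < δ → 0 < inner ℝ (β s) (β t) := by
  obtain ⟨t₀, ht₀, hmin⟩ := isCompact_Icc.exists_isMinOn (nonempty_Icc.2 zero_le_one) hβ.norm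
  obtain ⟨δ, hδ, h⟩ := Metric.uniformContinuousOn_iff.1
    (isCompact_Icc.uniformContinuousOn_of_continuous hβ) ‖β t₀‖ (norm_pos_iff.2 (h0 t₀ ht₀))
  refine ⟨δ, hδ, fun s hs t ht hst => ?_⟩
  have h1 := h s hs t ht (by rwa [Real.dist_eq])
  rw [dist_eq_norm] at h1
  have h2 : ‖β t₀‖ ≤ ‖β s‖ := hmin hs
  have h3 := norm_sub_sq_real (β s) (β t)
  have h4 : ‖β s - β t‖ ^ 2 < ‖β s‖ ^ 2 := by
    have := norm_nonneg (β s - β t)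
    gcongr
    exact h1.trans_le h2
  nlinarith [sq_nonneg ‖β t‖]

/-- Curves in the Segre–Veronese manifold have continuous lifts. -/
theorem exists_continuous_lift (hk : ∀ i, 1 ≤ k i) {β : ℝ → TensorSpace n k}
    (hβ : ContinuousOn β (Icc 0 1)) (hS : ∀ t ∈ Icc (0 : ℝ) 1, β t ∈ segreVeronese n k)
    {p : PreSpace n} (hp : p ∈ preSegreVeronese n) (hp0 : tensorMap n k p = β 0) :
    ∃ γ : ℝ → PreSpace n, ContinuousOn γ (Icc 0 1) ∧ γ 0 = p ∧
      ∀ t ∈ Icc (0 : ℝ) 1, γ t ∈ preSegreVeronese n ∧ tensorMap n k (γ t) = β t := by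
  obtain ⟨δ, hδ, hpos⟩ := exists_inner_pos hβ fun t ht => ne_zero_of_mem_segreVeronese (hS t ht)
  -- The lift is extended in steps of `δ / 2`. On each step the curve stays within the domain of
  -- positivity of the section based at the last lifted point.
  have key : ∀ j : ℕ, ∃ γ : ℝ → PreSpace n, ContinuousOn γ (Icc 0 (min (j * (δ / 2)) 1)) ∧ γ 0 = p ∧
      ∀ t ∈ Icc (0 : ℝ) (min (j * (δ / 2)) 1),
        γ t ∈ preSegreVeronese n ∧ tensorMap n k (γ t) = β t := by
    intro j
    induction j with
    | zero =>
      refine ⟨fun _ => p, continuousOn_const, rfl, fun t ht => ?_⟩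
      have : t = 0 := by
        have := ht.2
        simp only [Nat.cast_zero, zero_mul] at this
        exact le_antisymm (this.trans (min_le_left _ _)) ht.1
      exact ⟨hp, this ▸ hp0⟩
    | succ j ih =>
      obtain ⟨γ, h1, h2, h3⟩ := ih
      set a := min ((j : ℝ) * (δ / 2)) 1 with ha
      set b := min (((j + 1 : ℕ) : ℝ) * (δ / 2)) 1 with hb
      have ha0 : 0 ≤ a := le_min (by positivity) zero_le_one
      have hab : a ≤ b := min_le_min_right _ (by push_cast; nlinarith)
      have hb1 : b ≤ 1 := min_le_right _ _
      have hba : b < a + δ := by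
        rcases min_cases ((j : ℝ) * (δ / 2)) 1 with h | h
        · rw [ha, h.1]
          refine (min_le_left _ _).trans_lt ?_
          push_cast; nlinarith
        · rw [ha, h.1]; linarith
      obtain ⟨hga, hga'⟩ := h3 a ⟨ha0, le_rfl⟩
      have hin : ∀ t ∈ Icc a b, 0 < inner ℝ (β t) (pureTensorMap n k (slots n k (γ a))) := by
        intro t ht
        refine inner_pureTensorMap_slots_pos hga ?_
        rw [hga']
        refine hpos t ⟨ha0.trans ht.1, ht.2.trans hb1⟩ a ⟨ha0, hab.trans hb1⟩ ?_
        rw [abs_of_nonneg (by linarith [ht.1])]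
        linarith [ht.2]
      have hSt : ∀ t ∈ Icc a b, β t ∈ segreVeronese n k := fun t ht =>
        hS t ⟨ha0.trans ht.1, ht.2.trans hb1⟩
      set γ' : ℝ → PreSpace n := fun t => if t ≤ a then γ t else localSection hk (γ a) (β t) with hγ'
      have e1 : EqOn γ' γ (Icc 0 a) := fun t ht => if_pos ht.2
      have e2 : EqOn γ' (fun t => localSection hk (γ a) (β t)) (Icc a b) := by
        intro t ht
        rcases ht.1.eq_or_lt with rfl | h
        · simp only [hγ', le_refl, if_true]
          rw [← hga', localSection_tensorMap_of_pos hk hga fun i => ?_]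
          rw [real_inner_self_eq_norm_sq, hga.2 i]
          norm_num
        · exact if_neg (not_le.2 h)
      refine ⟨γ', ?_, ?_, fun t ht => ?_⟩
      · rw [← Icc_union_Icc_eq_Icc ha0 hab]
        refine ContinuousOn.union_of_isClosed (h1.congr e1) ?_ isClosed_Icc isClosed_Icc
        refine ContinuousOn.congr (fun t ht => ?_) e2
        exact ((contDiffAt_localSection hk (hSt t ht) (hin t ht)).continuousAt).comp_continuousWithinAt
          ((hβ.mono (Icc_subset_Icc ha0 hb1)) t ht)
      · rw [e1 ⟨le_rfl, ha0⟩, h2]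
      · rcases le_total t a with h | h
        · rw [e1 ⟨ht.1, h⟩]
          exact h3 t ⟨ht.1, h⟩
        · rw [e2 ⟨h, ht.2⟩]
          exact ⟨localSection_mem hk (hSt t ⟨h, ht.2⟩) (hin t ⟨h, ht.2⟩),
            tensorMap_localSection hk (hSt t ⟨h, ht.2⟩) (hin t ⟨h, ht.2⟩)⟩
  obtain ⟨j, hj⟩ := exists_nat_ge (1 / (δ / 2))
  have hj1 : min ((j : ℝ) * (δ / 2)) 1 = 1 := min_eq_right ((div_le_iff₀ (by positivity)).1 hj)
  have := key j
  rwa [hj1] at this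

/-- Piecewise smooth curves in the Segre–Veronese manifold have piecewise smooth lifts. -/
theorem exists_lift (hk : ∀ i, 1 ≤ k i) {β : ℝ → TensorSpace n k}
    (hβ : IsPiecewiseSmoothCurve (segreVeronese n k) β) {p : PreSpace n}
    (hp : p ∈ preSegreVeronese n) (hp0 : tensorMap n k p = β 0) :
    ∃ γ : ℝ → PreSpace n, IsPiecewiseSmoothCurve (preSegreVeronese n) γ ∧ γ 0 = p ∧
      EqOn (tensorMap n k ∘ γ) β (Icc 0 1) := by
  obtain ⟨hc, hS, F, hF⟩ := hβ
  obtain ⟨γ, h1, h2, h3⟩ := exists_continuous_lift hk hc hS hp hp0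
  refine ⟨γ, ⟨h1, fun t ht => (h3 t ht).1, F, fun a b ha hab hb hf t ht => ?_⟩, h2,
    fun t ht => (h3 t ht).2⟩
  have hsub : Icc a b ⊆ Icc 0 1 := Icc_subset_Icc ha hb
  obtain ⟨hm, hmt⟩ := h3 t (hsub ht)
  have hself : ∀ i, (0 : ℝ) < inner ℝ ((γ t).2 i) ((γ t).2 i) := fun i => by
    rw [real_inner_self_eq_norm_sq, hm.2 i]; norm_num
  -- Near `t` the continuous lift stays in the hemispheres around `γ t`, so it coincides with the
  -- smooth local section applied to `β`.
  have hnear : ∀ᶠ s in 𝓝[Icc a b] t, ∀ i, (0 : ℝ) < inner ℝ ((γ s).2 i) ((γ t).2 i) := by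
    refine eventually_all.2 fun i => ?_
    have : ContinuousWithinAt (fun s => (inner ℝ ((γ s).2 i) ((γ t).2 i) : ℝ)) (Icc a b) t :=
      (((continuous_apply i).comp continuous_snd).continuousAt.comp_continuousWithinAt
        ((h1.mono hsub) t ht)).inner continuousWithinAt_const
    exact this.eventually (lt_mem_nhds (hself i))
  have hin : 0 < inner ℝ (β t) (pureTensorMap n k (slots n k (γ t))) := by
    refine inner_pureTensorMap_slots_pos hm ?_
    rw [hmt, real_inner_self_eq_norm_sq]
    have := norm_pos_iff.2 (ne_zero_of_mem_segreVeronese (hS t (hsub ht)))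
    positivity
  refine ((contDiffAt_localSection hk (hS t (hsub ht)) hin).comp_contDiffWithinAt t
    (hF a b ha hab hb hf t ht)).congr_of_eventuallyEq ?_ ?_
  · filter_upwards [hnear, self_mem_nhdsWithin] with s hs hsm
    rw [Function.comp_apply, ← (h3 s (hsub hsm)).2,
      localSection_tensorMap_of_pos hk (h3 s (hsub hsm)).1 hs]
  · rw [Function.comp_apply, ← hmt, localSection_tensorMap_of_pos hk hm hself]

theorem IsPiecewiseSmoothCurve.tensorMap_comp {γ : ℝ → PreSpace n}
    (h : IsPiecewiseSmoothCurve (preSegreVeronese n) γ) :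
    IsPiecewiseSmoothCurve (segreVeronese n k) (tensorMap n k ∘ γ) := by
  obtain ⟨h1, h2, S, hS⟩ := h
  exact ⟨contDiff_tensorMap.continuous.comp_continuousOn h1, fun t ht => mem_image_of_mem _ (h2 t ht),
    S, fun a b ha hab hb hf => contDiff_tensorMap.comp_contDiffOn (hS a b ha hab hb hf)⟩

/-- The map `⊗` preserves the speed. -/
theorem speed_tensorMap_comp (α : ℝ) {γ : ℝ → PreSpace n}
    (h : IsPiecewiseSmoothCurve (preSegreVeronese n) γ) {t : ℝ} (ht : t ∈ Ioo (0 : ℝ) 1)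
    (hd : DifferentiableAt ℝ γ t) :
    speed (warpedMetric α) (tensorMap n k ∘ γ) t = speed (preMetric n k α) γ t := by
  have h1 : HasDerivAt (tensorMap n k ∘ γ) (fderiv ℝ (tensorMap n k) (γ t) (deriv γ t)) t :=
    (hasFDerivAt_tensorMap (γ t)).1.comp_hasDerivAt t hd.hasDerivAt
  have htan := tangent_of_hasDerivWithinAt (hd.hasDerivAt.hasDerivWithinAt (s := Ioo 0 1))
    (isOpen_Ioo.uniqueDiffWithinAt ht) ht fun x hx => h.2.1 x (Ioo_subset_Icc_self hx)
  rw [speed, speed, h1.deriv, Function.comp_apply, warpedMetric_fderiv_tensorMap α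
    (h.2.1 t (Ioo_subset_Icc_self ht)) htan]

theorem curveLength_tensorMap_comp (α : ℝ) {γ : ℝ → PreSpace n}
    (h : IsPiecewiseSmoothCurve (preSegreVeronese n) γ) :
    curveLength (warpedMetric α) (tensorMap n k ∘ γ) = curveLength (preMetric n k α) γ := by
  have h' := h
  obtain ⟨-, -, S, hS⟩ := h'
  exact setLIntegral_Icc_congr S fun t ht htS => by
    rw [speed_tensorMap_comp α h ht (exists_differentiableAt_off_finset hS ht htS)]

end Lifting

end SegreVeronese

namespace SegreVeronese

open MeasureTheory Set Filter Topology InnerProductGeometry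

/-! ### Logarithms on both manifolds. -/

section Logarithm

variable {d : ℕ} {n k : Fin d → ℕ}

theorem continuousAt_preMetric_of_mem (k : Fin d → ℕ) (α : ℝ) : ∀ x ∈ preSegreVeronese n, ∀ v,
    ContinuousAt (fun z : PreSpace n × PreSpace n => preMetric n k α z.1 z.2 z.2) (x, v) :=
  fun x _ v => continuousAt_preMetric α x v

theorem continuousAt_warpedMetric_of_mem (α : ℝ) : ∀ x ∈ segreVeronese n k, ∀ v,
    ContinuousAt (fun z : TensorSpace n k × TensorSpace n k => warpedMetric α z.1 z.2 z.2) (x, v) :=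
  fun _ hx v => continuousAt_warpedMetric α (ne_zero_of_mem_segreVeronese hx) v

/-- A continuous curve is differentiable where its image under `⊗` is. -/
theorem differentiableAt_of_tensorMap_comp (hk : ∀ i, 1 ≤ k i) {γ : ℝ → PreSpace n}
    (h : IsPiecewiseSmoothCurve (preSegreVeronese n) γ) {t : ℝ} (ht : t ∈ Ioo (0 : ℝ) 1)
    (hd : DifferentiableAt ℝ (tensorMap n k ∘ γ) t) : DifferentiableAt ℝ γ t := by
  have hm := h.2.1 t (Ioo_subset_Icc_self ht)
  have hself : ∀ i, (0 : ℝ) < inner ℝ ((γ t).2 i) ((γ t).2 i) := fun i => by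
    rw [real_inner_self_eq_norm_sq, hm.2 i]; norm_num
  have hnear : ∀ᶠ s in 𝓝 t, ∀ i, (0 : ℝ) < inner ℝ ((γ s).2 i) ((γ t).2 i) := by
    refine eventually_all.2 fun i => ?_
    have : ContinuousAt (fun s => (inner ℝ ((γ s).2 i) ((γ t).2 i) : ℝ)) t :=
      (((continuous_apply i).comp continuous_snd).continuousAt.comp
        (h.1.continuousAt (Icc_mem_nhds ht.1 ht.2))).inner continuousAt_const
    exact this.eventually (lt_mem_nhds (hself i))
  have hin : 0 < inner ℝ (tensorMap n k (γ t)) (pureTensorMap n k (slots n k (γ t))) := by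
    refine inner_pureTensorMap_slots_pos hm ?_
    rw [real_inner_self_eq_norm_sq, norm_tensorMap hm]
    have := hm.1
    positivity
  refine (((contDiffAt_localSection hk (mem_image_of_mem _ hm) hin).differentiableAt
    (by simp)).comp t hd).congr_of_eventuallyEq ?_
  filter_upwards [hnear, Ioo_mem_nhds ht.1 ht.2] with s hs hst
  rw [Function.comp_apply, Function.comp_apply,
    localSection_tensorMap_of_pos hk (h.2.1 s (Ioo_subset_Icc_self hst)) hs]

theorem hasDerivWithinAt_tensorMap_comp {γ : ℝ → PreSpace n} {v : PreSpace n} {s : Set ℝ} {t : ℝ}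
    (h : HasDerivWithinAt γ v s t) :
    HasDerivWithinAt (tensorMap n k ∘ γ) (fderiv ℝ (tensorMap n k) (γ t) v) s t :=
  (hasFDerivAt_tensorMap (γ t)).1.comp_hasDerivWithinAt t h

theorem coneDist_le_curveLength (hk : ∀ i, 1 ≤ k i) (α : ℝ) {p q : PreSpace n} {γ : ℝ → PreSpace n}
    (h : IsPiecewiseSmoothCurve (preSegreVeronese n) γ) (h0 : γ 0 = p) (h1 : (γ 1).1 = q.1)
    (hM : sphericalDist k p q ≤ sphericalDist k p (γ 1)) :
    ENNReal.ofReal (coneDist k α p q) ≤ curveLength (preMetric n k α) γ := by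
  have := ofReal_norm_sub_le_lintegral_speed hk α h le_rfl one_pos le_rfl
    (sphericalDist_nonneg k p q) (by rw [h0]; exact hM)
  rwa [h0, h1] at this

/-- A lift starting at `p` ends in a representative of `Q`, whose radius is `‖Q‖ = q.1` and whose
spherical distance from `p` is at least `M` by matching. The planar bound is available at the
smaller value `m = M`. -/
theorem coneDist_le_intrinsicDist_segreVeronese (hk : ∀ i, 1 ≤ k i) (α : ℝ) {P Q : TensorSpace n k}
    {p q : PreSpace n} (h : IsMatched P Q p q) :
    ENNReal.ofReal (coneDist k α p q) ≤
      intrinsicDist (segreVeronese n k) (warpedMetric α) P Q := by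
  obtain ⟨⟨hp, hP⟩, ⟨hq, hQ⟩, hmin⟩ := h
  refine le_iInf₂ fun β hβ => ?_
  obtain ⟨hβ, hβ0, hβ1⟩ := hβ
  obtain ⟨γ, hγ, hγ0, hγβ⟩ := exists_lift hk hβ hp (by rw [hP, hβ0])
  have hγ1 : tensorMap n k (γ 1) = Q := (hγβ ⟨zero_le_one, le_rfl⟩).trans hβ1
  have hm1 := hγ.2.1 1 ⟨zero_le_one, le_rfl⟩
  calc _ ≤ curveLength (preMetric n k α) γ := by
        refine coneDist_le_curveLength hk α hγ hγ0 ?_ (hmin _ _ ⟨hp, hP⟩ ⟨hm1, hγ1⟩)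
        rw [← norm_tensorMap (k := k) hm1, ← norm_tensorMap (k := k) hq, hγ1, hQ]
    _ = curveLength (warpedMetric α) (tensorMap n k ∘ γ) := (curveLength_tensorMap_comp α hγ).symm
    _ = curveLength (warpedMetric α) β := setLIntegral_speed_congr hγβ

/-- The derivative of `⊗` maps logarithms to logarithms. -/
theorem fderiv_tensorMap_mem_logSet (hk : ∀ i, 1 ≤ k i) {α : ℝ} (hα : 0 < α) {P Q : TensorSpace n k}
    {p q : PreSpace n} (h : IsMatched P Q p q) (hpq : IsCompatible k α p q) {w : PreSpace n}
    (hw : w ∈ logSet (preSegreVeronese n) (preMetric n k α) p q) :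
    fderiv ℝ (tensorMap n k) p w ∈ logSet (segreVeronese n k) (warpedMetric α) P Q := by
  rw [mem_logSet_iff (continuousAt_preMetric_of_mem k α)] at hw
  rw [mem_logSet_iff (continuousAt_warpedMetric_of_mem α)]
  obtain ⟨γ, hγ, h0, h1, hd, c, hc, hcd⟩ := hw
  -- Antipodal components are not excluded here; the given geodesic supplies the directions for the
  -- distance formula.
  obtain ⟨e, he⟩ := exists_isDirection hγ h0 h1
  have hp := h.1.1
  have hq := h.2.1.1
  have hc' : ∀ t ∈ Ioo (0 : ℝ) 1, DifferentiableAt ℝ (tensorMap n k ∘ γ) t →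
      speed (warpedMetric α) (tensorMap n k ∘ γ) t = c := fun t ht hdt => by
    have hdt' := differentiableAt_of_tensorMap_comp hk hγ ht hdt
    rw [speed_tensorMap_comp α hγ ht hdt', hc t ht hdt']
  have hT0 : (tensorMap n k ∘ γ) 0 = P := by rw [Function.comp_apply, h0, h.1.2]
  have hT1 : (tensorMap n k ∘ γ) 1 = Q := by rw [Function.comp_apply, h1, h.2.1.2]
  refine ⟨tensorMap n k ∘ γ, hγ.tensorMap_comp, hT0, hT1,
    h0 ▸ hasDerivWithinAt_tensorMap_comp hd, c, hc', le_antisymm ?_ ?_⟩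
  · rw [hcd, intrinsicDist_eq_coneDist hα hp hq hpq he hk]
    exact coneDist_le_intrinsicDist_segreVeronese hk α h
  · rw [← curveLength_of_const hγ.tensorMap_comp hc']
    exact iInf₂_le (f := fun (β : ℝ → TensorSpace n k)
      (_ : IsPiecewiseSmoothCurve (segreVeronese n k) β ∧ β 0 = P ∧ β 1 = Q) =>
        curveLength (warpedMetric α) β) _ ⟨hγ.tensorMap_comp, hT0, hT1⟩

/-- Uniqueness of minimizing curves of constant speed. -/
theorem eqOn_coneGeodesic (hk : ∀ i, 1 ≤ k i) {α : ℝ} (hα : 0 < α) {p q : PreSpace n}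
    (hpq : IsCompatible k α p q) (hne : ∀ i, p.2 i ≠ -q.2 i) {γ : ℝ → PreSpace n}
    (hγ : IsPiecewiseSmoothCurve (preSegreVeronese n) γ) (h0 : γ 0 = p) (h1 : γ 1 = q) {c : ℝ}
    (hc : ∀ t ∈ Ioo (0 : ℝ) 1, DifferentiableAt ℝ γ t → speed (preMetric n k α) γ t = c)
    (hcd : ENNReal.ofReal c = ENNReal.ofReal (coneDist k α p q)) :
    EqOn γ (coneGeodesic k α p q (uniqueDirection p q)) (Icc 0 1) := by
  have hp : p ∈ preSegreVeronese n := h0 ▸ hγ.2.1 0 ⟨le_rfl, zero_le_one⟩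
  have hq : q ∈ preSegreVeronese n := h1 ▸ hγ.2.1 1 ⟨zero_le_one, le_rfl⟩
  have hL : 0 ≤ coneDist k α p q := norm_nonneg _
  -- Constant speed distributes the total length evenly, so the lower bound applies to every
  -- subinterval with its share `b - a`.
  have hbound : ∀ a b m : ℝ, 0 ≤ a → a < b → b ≤ 1 → 0 ≤ m → m ≤ sphericalDist k (γ a) (γ b) →
      ‖((γ a).1 : ℂ) - (γ b).1 * Complex.exp ((α * m : ℝ) * Complex.I)‖ ≤
        (b - a) * coneDist k α p q := by
    intro a b m ha hab hb hm0 hm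
    have := ofReal_norm_sub_le_lintegral_speed hk α hγ ha hab hb hm0 hm
    rw [setLIntegral_speed_of_const hγ hc ha hb, hcd, ← ENNReal.ofReal_mul hL,
      mul_comm (coneDist k α p q)] at this
    exact (ENNReal.ofReal_le_ofReal_iff (mul_nonneg (by linarith) hL)).1 this
  intro t ht
  rcases ht.1.eq_or_lt with rfl | ht0
  · rw [coneGeodesic_zero hp, h0]
  rcases ht.2.eq_or_lt with rfl | ht1
  · rw [coneGeodesic_one hα hq hpq (isDirection_uniqueDirection hp hq hne) hk, h1]
  refine eq_coneGeodesic_of_dist_le hk hα hp hq (hγ.2.1 t ht) hpq hne (fun m hm0 hm => ?_)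
    fun m hm0 hm => ?_
  · have := hbound 0 t m le_rfl ht0 ht.2 hm0 (by rwa [h0])
    rwa [h0, sub_zero] at this
  · have := hbound t 1 m ht.1 ht1 le_rfl hm0 (by rwa [h1])
    rwa [h1] at this

theorem hasDerivWithinAt_coneGeodesic_zero (hk : ∀ i, 1 ≤ k i) {α : ℝ} (hα : 0 < α)
    {p q : PreSpace n} (hp : p ∈ preSegreVeronese n) (hq : q ∈ preSegreVeronese n)
    (hpq : IsCompatible k α p q) :
    HasDerivWithinAt (coneGeodesic k α p q (uniqueDirection p q)) (preLog k α p q) (Icc 0 1) 0 := by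
  rw [← coneVelocity_zero hk hα hp hq]
  exact (hasDerivAt_coneGeodesic hα hp hq hpq ⟨le_rfl, zero_le_one⟩).hasDerivWithinAt

/-- The logarithm on the pre-Segre–Veronese manifold. -/
theorem logSet_preSegreVeronese (hk : ∀ i, 1 ≤ k i) {α : ℝ} (hα : 0 < α) {p q : PreSpace n}
    (hp : p ∈ preSegreVeronese n) (hq : q ∈ preSegreVeronese n) (hpq : IsCompatible k α p q)
    (hne : ∀ i, p.2 i ≠ -q.2 i) :
    logSet (preSegreVeronese n) (preMetric n k α) p q = {preLog k α p q} := by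
  have he := isDirection_uniqueDirection hp hq hne
  have hdist := intrinsicDist_eq_coneDist hα hp hq hpq he hk
  have hd0 := hasDerivWithinAt_coneGeodesic_zero hk hα hp hq hpq
  ext v
  rw [mem_logSet_iff (continuousAt_preMetric_of_mem k α), mem_singleton_iff, hdist]
  constructor
  · rintro ⟨γ, hγ, h0, h1, hd, c, hc, hcd⟩
    have heq := eqOn_coneGeodesic hk hα hpq hne hγ h0 h1 hc hcd
    exact (uniqueDiffOn_Icc zero_lt_one 0 ⟨le_rfl, zero_le_one⟩).eq_deriv _ hd
      (hd0.congr heq (heq ⟨le_rfl, zero_le_one⟩))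
  · rintro rfl
    exact ⟨_, isPiecewiseSmoothCurve_coneGeodesic hα hp hq hpq he, coneGeodesic_zero hp,
      coneGeodesic_one hα hq hpq he hk, hd0, coneDist k α p q,
      fun t ht _ => speed_coneGeodesic hα hp hq hpq he (Ioo_subset_Icc_self ht), rfl⟩

/-- The logarithm on the Segre–Veronese manifold. -/
theorem logSet_segreVeronese_subset (hk : ∀ i, 1 ≤ k i) {α : ℝ} (hα : 0 < α) {P Q : TensorSpace n k}
    {p q : PreSpace n} (h : IsMatched P Q p q) (hpq : IsCompatible k α p q)
    (hne : ∀ i, p.2 i ≠ -q.2 i) (huniq : ∀ q', IsMatched P Q p q' → q' = q) :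
    logSet (segreVeronese n k) (warpedMetric α) P Q ⊆
      {fderiv ℝ (tensorMap n k) p (preLog k α p q)} := by
  have hp := h.1.1
  have hq := h.2.1.1
  have he := isDirection_uniqueDirection hp hq hne
  have hL : 0 ≤ coneDist k α p q := norm_nonneg _
  have hdist : intrinsicDist (segreVeronese n k) (warpedMetric α) P Q =
      ENNReal.ofReal (coneDist k α p q) := by
    refine le_antisymm ?_ (coneDist_le_intrinsicDist_segreVeronese hk α h)
    have hγ := isPiecewiseSmoothCurve_coneGeodesic hα hp hq hpq he
    rw [← curveLength_of_const hγ fun t ht _ =>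
      speed_coneGeodesic hα hp hq hpq he (Ioo_subset_Icc_self ht), ← curveLength_tensorMap_comp α hγ]
    refine iInf₂_le (f := fun (β : ℝ → TensorSpace n k)
      (_ : IsPiecewiseSmoothCurve (segreVeronese n k) β ∧ β 0 = P ∧ β 1 = Q) =>
        curveLength (warpedMetric α) β) _ ⟨hγ.tensorMap_comp, ?_, ?_⟩
    · rw [Function.comp_apply, coneGeodesic_zero hp, h.1.2]
    · rw [Function.comp_apply, coneGeodesic_one hα hq hpq he hk, h.2.1.2]
  intro v hv
  rw [mem_logSet_iff (continuousAt_warpedMetric_of_mem α), hdist] at hv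
  obtain ⟨β, hβ, hβ0, hβ1, hd, c, hc, hcd⟩ := hv
  obtain ⟨γ, hγ, hγ0, hγβ⟩ := exists_lift hk hβ hp (by rw [h.1.2, hβ0])
  have hγ1 : tensorMap n k (γ 1) = Q := (hγβ ⟨zero_le_one, le_rfl⟩).trans hβ1
  have hm1 := hγ.2.1 1 ⟨zero_le_one, le_rfl⟩
  have hfst : (γ 1).1 = q.1 := by
    rw [← norm_tensorMap (k := k) hm1, ← norm_tensorMap (k := k) hq, hγ1, h.2.1.2]
  have hcγ : ∀ t ∈ Ioo (0 : ℝ) 1, DifferentiableAt ℝ γ t → speed (preMetric n k α) γ t = c := by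
    intro t ht hdt
    have hev := eventuallyEq_of_eqOn_Icc hγβ ht
    rw [← speed_tensorMap_comp α hγ ht hdt, speed_congr hev]
    exact hc t ht (((hasFDerivAt_tensorMap (γ t)).1.differentiableAt.comp t hdt).congr_of_eventuallyEq
      hev.symm)
  have hlen : curveLength (preMetric n k α) γ = ENNReal.ofReal (coneDist k α p q) := by
    rw [curveLength_of_const hγ hcγ, hcd]
  -- The lift might end in another representative of `Q`. Being no longer than the chord for `M`, it
  -- cannot reach a larger spherical distance, so its end point is also matched with `p` and equals
  -- `q`.
  have hle : sphericalDist k p (γ 1) ≤ sphericalDist k p q := by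
    refine le_of_forall_norm_sub_polar_le (C := coneDist k α p q) hα hp.1 hq.1
      (sphericalDist_nonneg k p q) (mul_sphericalDist_lt_pi hα hpq) (fun m hm0 hm => ?_) le_rfl
    have := ofReal_norm_sub_le_lintegral_speed hk α hγ le_rfl one_pos le_rfl hm0 (by rwa [hγ0])
    rw [hγ0, hfst] at this
    exact (ENNReal.ofReal_le_ofReal_iff hL).1 (this.trans hlen.le)
  have hqq : γ 1 = q := huniq _ ⟨h.1, ⟨hm1, hγ1⟩, fun p' q' hp' hq' => hle.trans (h.2.2 p' q' hp' hq')⟩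
  have heq := eqOn_coneGeodesic hk hα hpq hne hγ hγ0 hqq hcγ hcd
  have hd0 := hasDerivWithinAt_tensorMap_comp (k := k)
    (hasDerivWithinAt_coneGeodesic_zero hk hα hp hq hpq)
  rw [coneGeodesic_zero hp] at hd0
  have heq' : EqOn β (tensorMap n k ∘ coneGeodesic k α p q (uniqueDirection p q)) (Icc 0 1) :=
    fun t ht => by rw [← hγβ ht, Function.comp_apply, Function.comp_apply, heq ht]
  exact (uniqueDiffOn_Icc zero_lt_one 0 ⟨le_rfl, zero_le_one⟩).eq_deriv _ hd
    (hd0.congr heq' (heq' ⟨le_rfl, zero_le_one⟩))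

end Logarithm

end SegreVeronese

end

theorem mainTheorem1 {d : ℕ} (n k : Fin d → ℕ) (hk : ∀ i, 1 ≤ k i) (α : ℝ) (hα : 0 < α)
    (P Q : SegreVeronese.TensorSpace n k) (p q : SegreVeronese.PreSpace n)
    (hmatched : SegreVeronese.IsMatched P Q p q)
    (hcompatible : SegreVeronese.IsCompatible k α p q) :
    (∀ w ∈ SegreVeronese.logSet (SegreVeronese.preSegreVeronese n)
        (SegreVeronese.preMetric n k α) p q,
      fderiv ℝ (SegreVeronese.tensorMap n k) p w ∈
        SegreVeronese.logSet (SegreVeronese.segreVeronese n k)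
          (SegreVeronese.warpedMetric α) P Q) ∧
    ((∀ i, p.2 i ≠ -q.2 i) →
      SegreVeronese.logSet (SegreVeronese.preSegreVeronese n)
          (SegreVeronese.preMetric n k α) p q = {SegreVeronese.preLog k α p q} ∧
      fderiv ℝ (SegreVeronese.tensorMap n k) p (SegreVeronese.preLog k α p q) ∈
        SegreVeronese.logSet (SegreVeronese.segreVeronese n k)
          (SegreVeronese.warpedMetric α) P Q ∧
      ((∀ q', SegreVeronese.IsMatched P Q p q' → q' = q) →
        SegreVeronese.logSet (SegreVeronese.segreVeronese n k)
            (SegreVeronese.warpedMetric α) P Q =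
          {fderiv ℝ (SegreVeronese.tensorMap n k) p (SegreVeronese.preLog k α p q)})) := by
  have hp := hmatched.1.1
  have hq := hmatched.2.1.1
  refine ⟨fun w hw => SegreVeronese.fderiv_tensorMap_mem_logSet hk hα hmatched hcompatible hw,
    fun hne => ?_⟩
  have hlog := SegreVeronese.logSet_preSegreVeronese hk hα hp hq hcompatible hne
  have hmem := SegreVeronese.fderiv_tensorMap_mem_logSet hk hα hmatched hcompatible
    (hlog.symm ▸ Set.mem_singleton _)
  exact ⟨hlog, hmem, fun huniq => Set.Subset.antisymm
    (SegreVeronese.logSet_segreVeronese_subset hk hα hmatched hcompatible hne huniq)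
    (Set.singleton_subset_iff.2 hmem)⟩
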